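/- Let $\pi:E\to M$ be a fibered manifold, i.e. a smooth surjective submersion, with $\dim M=n$ and $\dim E=m=n+k$. Indices $i,a$ run over $1,\dots,n$, indices $A$ over the remaining $k$ values, and $\alpha=(i,A)$. Let $LE$ be the bundle of linear frames of $E$, with projection $\lambda:LE\to E$, and let $\hat\theta=(\theta^\alpha)$ be its $\mathbb R^m$-valued soldering 1-form: $\theta^\alpha_u(X)=e^\alpha(\lambda_*X)$ for a frame $u=(e,e_\alpha)$ with dual frame $(e^\alpha)$. Let $L_\pi E\subset LE$ be the bundle of adapted frames $u=(e,e_i,e_A)$, those with every $e_A$ vertical ($\pi_*e_A=0$); the restrictions of $\theta^i,\theta^A$ to $L_\pi E$ are denoted by the same symbols. Let $J^1\pi$ be the first jet bundle, the manifold of all linear right inverses $T_{\pi(e)}M\to T_eE$ of $\pi_*(e)$, $e\in E$, and let $\rho:L_\pi E\to J^1\pi$ send $(e,e_i,e_A)$ to the linear map $\pi_*e_i\mapsto e_i$. Let $\mathcal L:J^1\pi\to\mathbb R$ be a smooth Lagrangian whose pull-up $L=\rho^*\mathcal L$ to $L_\pi E$ vanishes nowhere, and let $\tau$ be a positive function of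 $n$. Write $$E^{*i}_A(L)(u)=\frac{d}{dt}\Big|_{t=0}L(u\cdot\exp(tE^i_A))=\frac{d}{dt}\Big|_{t=0}L(e,e_1,\dots,e_i+t\,e_A,\dots,e_n,e_B)$$ for the derivative of $L$ along the fundamental vertical vector field of the standard basis element $E^i_A\in\mathfrak{gl}(m,\mathbb R)$. The $m$-symplectic Legendre transformation $\phi_L:L_\pi E\to LE$ is $$\phi_L(e,e_i,e_A)=\Big(e,\ \frac{1}{\tau(n)L(u)}\,e_i,\ e_A-\frac{1}{\tau(n)L(u)}\sum_{a=1}^nE^{*a}_A(L)(u)\,e_a\Big),\qquad u=(e,e_i,e_A),$$ and the $\mathbb R^m$-valued Cartan–Hamilton–Poincaré 1-form $\hat\theta_L=(\theta^i_L,\theta^A_L)$ on $L_\pi E$ is $$\theta^i_L=\tau(n)L\,\theta^i+\sum_AE^{*i}_A(L)\,\theta^A,\qquad \theta^A_L=\theta^A .$$ Then $\phi_L$ is a smooth map from $L_\pi E$ to $LE$, and $$\phi_L^*\hat\theta=\hat\theta_L .$$ -/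

import Mathlib

open Bundle Set
open scoped Manifold ContDiff Topology

noncomputable section

/-- A fibered manifold `π : E → M` (surjective submersion) of an `(n + k)`-dimensional smooth manifold
`E` over an `n`-dimensional smooth manifold `M`. -/
structure FiberedManifold (n k : ℕ) (E M : Type*)
    [TopologicalSpace M] [ChartedSpace (EuclideanSpace ℝ (Fin n)) M] [IsManifold (𝓡 n) ∞ M]
    [TopologicalSpace E] [ChartedSpace (EuclideanSpace ℝ (Fin (n + k))) E]
    [IsManifold (𝓡 (n + k)) ∞ E] where
  proj : C^∞⟮𝓡 (n + k), E; 𝓡 n, M⟯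
  surjective : Function.Surjective proj
  submersion : ∀ e : E, Function.Surjective (mfderiv (𝓡 (n + k)) (𝓡 n) proj e)

instance {m : ℕ} {N : Type*} [TopologicalSpace N] [ChartedSpace (EuclideanSpace ℝ (Fin m)) N]
    (x : N) : T2Space (TangentSpace (𝓡 m) x) :=
  inferInstanceAs (T2Space (EuclideanSpace ℝ (Fin m)))
instance {m : ℕ} {N : Type*} [TopologicalSpace N] [ChartedSpace (EuclideanSpace ℝ (Fin m)) N]
    (x : N) : FiniteDimensional ℝ (TangentSpace (𝓡 m) x) :=
  inferInstanceAs (FiniteDimensional ℝ (EuclideanSpace ℝ (Fin m)))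

lemma finrank_tangentSpace {m : ℕ} {N : Type*} [TopologicalSpace N]
    [ChartedSpace (EuclideanSpace ℝ (Fin m)) N] (x : N) :
    Module.finrank ℝ (TangentSpace (𝓡 m) x) = m :=
  finrank_euclideanSpace_fin (𝕜 := ℝ)

lemma isInvertible_of_injective {F G : Type*} [AddCommGroup F] [Module ℝ F] [TopologicalSpace F]
    [IsTopologicalAddGroup F] [ContinuousSMul ℝ F] [T2Space F] [FiniteDimensional ℝ F]
    [AddCommGroup G] [Module ℝ G] [TopologicalSpace G]
    [IsTopologicalAddGroup G] [ContinuousSMul ℝ G] [T2Space G] [FiniteDimensional ℝ G]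
    {f : F →L[ℝ] G} (hf : Function.Injective f)
    (h : Module.finrank ℝ F = Module.finrank ℝ G) : f.IsInvertible :=
  ⟨(LinearEquiv.ofInjectiveOfFinrankEq f.toLinearMap hf h).toContinuousLinearEquiv, by
    ext; rfl⟩

namespace FiberedManifold

variable {n k : ℕ} {E M : Type*}
  [TopologicalSpace M] [ChartedSpace (EuclideanSpace ℝ (Fin n)) M] [IsManifold (𝓡 n) ∞ M]
  [TopologicalSpace E] [ChartedSpace (EuclideanSpace ℝ (Fin (n + k))) E]
  [IsManifold (𝓡 (n + k)) ∞ E]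

variable (P : FiberedManifold n k E M)

/-- The fibre at `e` of the pull-back bundle `π^* TM`, i.e. the tangent space `T_{π(e)} M`. -/
def PullTM (e : E) : Type := TangentSpace (𝓡 n) (P.proj e)

instance (e : E) : AddCommGroup (P.PullTM e) :=
  inferInstanceAs (AddCommGroup (TangentSpace (𝓡 n) (P.proj e)))
instance (e : E) : Module ℝ (P.PullTM e) :=
  inferInstanceAs (Module ℝ (TangentSpace (𝓡 n) (P.proj e)))
instance (e : E) : TopologicalSpace (P.PullTM e) :=
  inferInstanceAs (TopologicalSpace (TangentSpace (𝓡 n) (P.proj e)))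
instance (e : E) : IsTopologicalAddGroup (P.PullTM e) :=
  inferInstanceAs (IsTopologicalAddGroup (TangentSpace (𝓡 n) (P.proj e)))
instance (e : E) : ContinuousSMul ℝ (P.PullTM e) :=
  inferInstanceAs (ContinuousSMul ℝ (TangentSpace (𝓡 n) (P.proj e)))
instance : TopologicalSpace (TotalSpace (EuclideanSpace ℝ (Fin n)) P.PullTM) :=
  inferInstanceAs (TopologicalSpace (TotalSpace (EuclideanSpace ℝ (Fin n))
    ((P.proj : E → M) *ᵖ (TangentSpace (𝓡 n) : M → Type _))))
instance : FiberBundle (EuclideanSpace ℝ (Fin n)) P.PullTM :=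
  inferInstanceAs (FiberBundle (EuclideanSpace ℝ (Fin n))
    ((P.proj : E → M) *ᵖ (TangentSpace (𝓡 n) : M → Type _)))
instance : VectorBundle ℝ (EuclideanSpace ℝ (Fin n)) P.PullTM :=
  inferInstanceAs (VectorBundle ℝ (EuclideanSpace ℝ (Fin n))
    ((P.proj : E → M) *ᵖ (TangentSpace (𝓡 n) : M → Type _)))
instance : ContMDiffVectorBundle ∞ (EuclideanSpace ℝ (Fin n)) P.PullTM (𝓡 (n + k)) :=
  inferInstanceAs (ContMDiffVectorBundle ∞ (EuclideanSpace ℝ (Fin n))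
    ((P.proj : E → M) *ᵖ (TangentSpace (𝓡 n) : M → Type _)) (𝓡 (n + k)))


/-- The differential `π_*(e) : T_e E → T_{π(e)} M`. -/
def dproj (P : FiberedManifold n k E M) (e : E) :
    TangentSpace (𝓡 (n + k)) e →L[ℝ] P.PullTM e :=
  mfderiv (𝓡 (n + k)) (𝓡 n) P.proj e

/-- The space of vertical vectors `V_e π = ker π_*(e) ⊆ T_e E`. -/
def vertical (P : FiberedManifold n k E M) (e : E) :
    Submodule ℝ (TangentSpace (𝓡 (n + k)) e) :=
  LinearMap.ker (P.dproj e).toLinearMap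

/-- The fibres of the vertical bundle `Vπ ⊆ TE`; it is made into a smooth vector bundle below. -/
def VertBundle (P : FiberedManifold n k E M) (e : E) : Type := P.vertical e

instance (e : E) : AddCommGroup (P.VertBundle e) := inferInstanceAs (AddCommGroup (P.vertical e))
instance (e : E) : Module ℝ (P.VertBundle e) := inferInstanceAs (Module ℝ (P.vertical e))
instance (e : E) : TopologicalSpace (P.VertBundle e) :=
  inferInstanceAs (TopologicalSpace (P.vertical e))
instance (e : E) : IsTopologicalAddGroup (P.VertBundle e) :=
  inferInstanceAs (IsTopologicalAddGroup (P.vertical e))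
instance (e : E) : ContinuousSMul ℝ (P.VertBundle e) :=
  inferInstanceAs (ContinuousSMul ℝ (P.vertical e))

/-- The inclusion `V_e π → T_e E`. -/
def vertIncl (e : E) : P.VertBundle e →L[ℝ] TangentSpace (𝓡 (n + k)) e := (P.vertical e).subtypeL

/-- Domain on which the tangent bundles of `E` and `M` are trivialized by the charts at `e₀` and
`π(e₀)`. -/
def chartDom (e₀ : E) : Set E :=
  (trivializationAt (EuclideanSpace ℝ (Fin (n + k))) (TangentSpace (𝓡 (n + k)) : E → Type _) e₀).baseSet ∩
    (trivializationAt (EuclideanSpace ℝ (Fin n)) P.PullTM e₀).baseSet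

/-- The differential `π_*(e)` read in the charts at `e₀` and `π(e₀)`. -/
def coordDproj (e₀ e : E) : EuclideanSpace ℝ (Fin (n + k)) →L[ℝ] EuclideanSpace ℝ (Fin n) :=
  ContinuousLinearMap.inCoordinates (EuclideanSpace ℝ (Fin (n + k))) (TangentSpace (𝓡 (n + k)) : E → Type _)
    (EuclideanSpace ℝ (Fin n)) P.PullTM e₀ e e₀ e (P.dproj e)

lemma mem_chartDom (e₀ : E) : e₀ ∈ P.chartDom e₀ :=
  ⟨FiberBundle.mem_baseSet_trivializationAt' e₀, FiberBundle.mem_baseSet_trivializationAt' e₀⟩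

lemma isOpen_chartDom (e₀ : E) : IsOpen (P.chartDom e₀) :=
  (Trivialization.open_baseSet _).inter (Trivialization.open_baseSet _)

lemma contMDiffOn_coordDproj (e₀ : E) :
    ContMDiffOn (𝓡 (n + k)) 𝓘(ℝ, EuclideanSpace ℝ (Fin (n + k)) →L[ℝ] EuclideanSpace ℝ (Fin n)) ∞ (P.coordDproj e₀) (P.chartDom e₀) := by
  have h : ContMDiff (𝓡 (n + k)) ((𝓡 (n + k)).prod 𝓘(ℝ, EuclideanSpace ℝ (Fin (n + k)) →L[ℝ] EuclideanSpace ℝ (Fin n))) ∞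
    (fun e => TotalSpace.mk' (EuclideanSpace ℝ (Fin (n + k)) →L[ℝ] EuclideanSpace ℝ (Fin n))
      (E := fun e : E => TangentSpace (𝓡 (n + k)) e →L[ℝ] P.PullTM e) e (P.dproj e)) := by
    intro e
    rw [contMDiffAt_hom_bundle]
    refine ⟨contMDiffAt_id, ?_⟩
    exact (P.proj.contMDiff e).mfderiv_const (by simp)
  have h2 := ((trivializationAt (EuclideanSpace ℝ (Fin (n + k)) →L[ℝ] EuclideanSpace ℝ (Fin n))
    (fun e : E => TangentSpace (𝓡 (n + k)) e →L[ℝ] P.PullTM e) e₀).contMDiffOn_section_baseSet_iff (IB := 𝓡 (n + k)) (n := ∞)).1 h.contMDiffOn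
  exact h2

lemma exists_compl (A : EuclideanSpace ℝ (Fin (n + k)) →L[ℝ] EuclideanSpace ℝ (Fin n)) (hA : Function.Surjective A) :
    ∃ q : EuclideanSpace ℝ (Fin (n + k)) →L[ℝ] EuclideanSpace ℝ (Fin k), (A.prod q).IsInvertible := by
  have hr := A.toLinearMap.finrank_range_add_finrank_ker
  rw [LinearMap.range_eq_top.2 hA, finrank_top] at hr
  simp only [finrank_euclideanSpace, Fintype.card_fin] at hr
  obtain ⟨C, hC⟩ := (LinearMap.ker A.toLinearMap).exists_isCompl
  have hk : Module.finrank ℝ (LinearMap.ker A.toLinearMap) = Module.finrank ℝ (EuclideanSpace ℝ (Fin k)) := by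
    simp; omega
  let ψ := LinearEquiv.ofFinrankEq _ _ hk
  let q : EuclideanSpace ℝ (Fin (n + k)) →ₗ[ℝ] EuclideanSpace ℝ (Fin k) :=
    ψ.toLinearMap ∘ₗ Submodule.projectionOnto _ C hC
  refine ⟨q.toContinuousLinearMap, ?_⟩
  have hinj : Function.Injective (A.prod q.toContinuousLinearMap) := by
    rw [injective_iff_map_eq_zero]
    intro v hv
    have h1 : A v = 0 := congrArg Prod.fst hv
    have h2 : q v = 0 := congrArg Prod.snd hv
    have h3 : Submodule.projectionOnto _ C hC v = 0 := by
      simpa [q] using h2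
    have h4 := Submodule.projectionOnto_apply_left hC ⟨v, h1⟩
    rw [h3] at h4
    exact (congrArg Subtype.val h4).symm
  exact ⟨(LinearEquiv.ofInjectiveOfFinrankEq (A.prod q.toContinuousLinearMap).toLinearMap hinj (by simp)).toContinuousLinearEquiv, by ext <;> rfl⟩

lemma surjective_coordDproj (e₀ : E) : Function.Surjective (P.coordDproj e₀ e₀) := by
  rw [coordDproj, ContinuousLinearMap.inCoordinates_eq (P.mem_chartDom e₀).1 (P.mem_chartDom e₀).2]
  rw [ContinuousLinearMap.coe_comp, ContinuousLinearMap.coe_comp]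
  exact (ContinuousLinearEquiv.surjective _).comp
    ((show Function.Surjective (P.dproj e₀) from P.submersion e₀).comp
      (ContinuousLinearEquiv.surjective _))

/-- A linear map completing `π_*(e₀)`, read in charts, to an isomorphism `ℝ^(n+k) ≅ ℝ^n × ℝ^k`. -/
def compl (e₀ : E) : EuclideanSpace ℝ (Fin (n + k)) →L[ℝ] EuclideanSpace ℝ (Fin k) :=
  (exists_compl _ (P.surjective_coordDproj e₀)).choose

/-- `(π_*(e), compl)` read in the charts at `e₀`; near `e₀` it is an isomorphism that carries vertical
vectors to `{0} × ℝ^k`. -/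
def splitting (e₀ e : E) :
    EuclideanSpace ℝ (Fin (n + k)) →L[ℝ] EuclideanSpace ℝ (Fin n) × EuclideanSpace ℝ (Fin k) :=
  (P.coordDproj e₀ e).prod (P.compl e₀)

/-- Domain of the local trivialization of `Vπ` around `e₀`. -/
def vertDom (e₀ : E) : Set E := P.chartDom e₀ ∩ {e | (P.splitting e₀ e).IsInvertible}

lemma mem_vertDom (e₀ : E) : e₀ ∈ P.vertDom e₀ :=
  ⟨P.mem_chartDom e₀, (exists_compl _ (P.surjective_coordDproj e₀)).choose_spec⟩

lemma contMDiffOn_splitting (e₀ : E) :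
    ContMDiffOn (𝓡 (n + k)) 𝓘(ℝ, EuclideanSpace ℝ (Fin (n + k)) →L[ℝ]
      EuclideanSpace ℝ (Fin n) × EuclideanSpace ℝ (Fin k)) ∞ (P.splitting e₀) (P.chartDom e₀) := by
  have h := P.contMDiffOn_coordDproj e₀
  have h2 : P.splitting e₀ = fun e =>
      (ContinuousLinearMap.inl ℝ (EuclideanSpace ℝ (Fin n)) (EuclideanSpace ℝ (Fin k))).comp (P.coordDproj e₀ e) +
      (ContinuousLinearMap.inr ℝ (EuclideanSpace ℝ (Fin n)) (EuclideanSpace ℝ (Fin k))).comp (P.compl e₀) := by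
    funext e
    refine ContinuousLinearMap.ext fun v => ?_
    refine Prod.ext ?_ ?_ <;> simp [splitting]
  rw [h2]
  exact (contMDiffOn_const.clm_comp h).add contMDiffOn_const

lemma isOpen_vertDom (e₀ : E) : IsOpen (P.vertDom e₀) :=
  (P.contMDiffOn_splitting e₀).continuousOn.isOpen_inter_preimage (P.isOpen_chartDom e₀)
    ContinuousLinearEquiv.isOpen

lemma contMDiffOn_inverse_splitting (e₀ : E) :
    ContMDiffOn (𝓡 (n + k)) 𝓘(ℝ, EuclideanSpace ℝ (Fin n) × EuclideanSpace ℝ (Fin k) →L[ℝ]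
      EuclideanSpace ℝ (Fin (n + k))) ∞ (fun e => (P.splitting e₀ e).inverse) (P.vertDom e₀) := by
  intro e he
  obtain ⟨φ, hφ⟩ := he.2
  have h1 : ContDiffAt ℝ ∞ ContinuousLinearMap.inverse (P.splitting e₀ e) := by
    rw [← hφ]; exact contDiffAt_map_inverse φ
  exact h1.contMDiffAt.comp_contMDiffWithinAt e ((P.contMDiffOn_splitting e₀ e he.1).mono inter_subset_left)

lemma coordDproj_continuousLinearMapAt {e₀ e : E} (he : e ∈ P.chartDom e₀)
    (v : TangentSpace (𝓡 (n + k)) e) :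
    P.coordDproj e₀ e ((trivializationAt (EuclideanSpace ℝ (Fin (n + k)))
      (TangentSpace (𝓡 (n + k)) : E → Type _) e₀).continuousLinearMapAt ℝ e v) =
    (trivializationAt (EuclideanSpace ℝ (Fin n)) P.PullTM e₀).continuousLinearMapAt ℝ e (P.dproj e v) := by
  simp only [coordDproj, ContinuousLinearMap.inCoordinates, ContinuousLinearMap.comp_apply]
  rw [Trivialization.symmL_continuousLinearMapAt _ he.1]

lemma dproj_symmL_eq_zero {e₀ e : E} (he : e ∈ P.chartDom e₀) (w : EuclideanSpace ℝ (Fin (n + k))) :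
    P.dproj e ((trivializationAt (EuclideanSpace ℝ (Fin (n + k)))
      (TangentSpace (𝓡 (n + k)) : E → Type _) e₀).symmL ℝ e w) = 0 ↔ P.coordDproj e₀ e w = 0 := by
  have h := P.coordDproj_continuousLinearMapAt he ((trivializationAt (EuclideanSpace ℝ (Fin (n + k)))
      (TangentSpace (𝓡 (n + k)) : E → Type _) e₀).symmL ℝ e w)
  rw [Trivialization.continuousLinearMapAt_symmL _ he.1] at h
  rw [h]
  constructor
  · intro h0; rw [h0]; exact map_zero _
  · intro h0
    have := congrArg ((trivializationAt (EuclideanSpace ℝ (Fin n)) P.PullTM e₀).symmL ℝ e) h0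
    rw [Trivialization.symmL_continuousLinearMapAt _ he.2, map_zero] at this
    exact this

lemma symmL_mem_vertical {e₀ e : E} (h : e ∈ P.vertDom e₀) (w : EuclideanSpace ℝ (Fin k)) :
    (trivializationAt (EuclideanSpace ℝ (Fin (n + k))) (TangentSpace (𝓡 (n + k)) : E → Type _)
      e₀).symmL ℝ e ((P.splitting e₀ e).inverse (0, w)) ∈ P.vertical e :=
  (P.dproj_symmL_eq_zero h.1 _).2 (congrArg Prod.fst (h.2.self_apply_inverse (0, w)))

open Classical in
def vertSymm (e₀ e : E) (w : EuclideanSpace ℝ (Fin k)) : P.VertBundle e :=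
  if h : e ∈ P.vertDom e₀ then (⟨_, P.symmL_mem_vertical h w⟩ : P.vertical e) else 0

/-- Local trivialization of `Vπ` around `e₀`, on fibres. -/
def vertCoord (e₀ e : E) : P.VertBundle e →L[ℝ] EuclideanSpace ℝ (Fin k) :=
  ((P.compl e₀).comp ((trivializationAt (EuclideanSpace ℝ (Fin (n + k)))
      (TangentSpace (𝓡 (n + k)) : E → Type _) e₀).continuousLinearMapAt ℝ e)).comp (P.vertIncl e)

lemma vertIncl_vertSymm {e₀ e : E} (h : e ∈ P.vertDom e₀) (w : EuclideanSpace ℝ (Fin k)) :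
    P.vertIncl e (P.vertSymm e₀ e w) =
    (trivializationAt (EuclideanSpace ℝ (Fin (n + k))) (TangentSpace (𝓡 (n + k)) : E → Type _) e₀).symmL ℝ e
      ((P.splitting e₀ e).inverse (0, w)) := by
  have h1 : P.vertSymm e₀ e w = (⟨_, P.symmL_mem_vertical h w⟩ : P.vertical e) := dif_pos h
  rw [h1]
  rfl

lemma vertCoord_vertSymm {e₀ e : E} (h : e ∈ P.vertDom e₀) (w : EuclideanSpace ℝ (Fin k)) :
    P.vertCoord e₀ e (P.vertSymm e₀ e w) = w := by
  simp only [vertCoord, ContinuousLinearMap.comp_apply]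
  rw [P.vertIncl_vertSymm h, Trivialization.continuousLinearMapAt_symmL _ h.1.1]
  exact congrArg Prod.snd (h.2.self_apply_inverse (0, w))

lemma vertCoord_injective {e₀ e : E} (h : e ∈ P.vertDom e₀) :
    Function.Injective (P.vertCoord e₀ e) := by
  rw [injective_iff_map_eq_zero]
  intro v hv
  have hv0 : P.dproj e (P.vertIncl e v) = 0 := v.2
  have h1 := P.coordDproj_continuousLinearMapAt h.1 (P.vertIncl e v)
  rw [hv0, map_zero] at h1
  have h2 : P.splitting e₀ e ((trivializationAt (EuclideanSpace ℝ (Fin (n + k)))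
      (TangentSpace (𝓡 (n + k)) : E → Type _) e₀).continuousLinearMapAt ℝ e (P.vertIncl e v)) = 0 :=
    Prod.ext h1 hv
  have h3 := h.2.injective (h2.trans (map_zero _).symm)
  have h4 := congrArg ((trivializationAt (EuclideanSpace ℝ (Fin (n + k)))
      (TangentSpace (𝓡 (n + k)) : E → Type _) e₀).symmL ℝ e) h3
  rw [Trivialization.symmL_continuousLinearMapAt _ h.1.1, map_zero] at h4
  exact Subtype.ext h4

/-- The local trivialization of `Vπ` around `e₀`. -/
def vertPretriv (e₀ : E) :
    Pretrivialization (EuclideanSpace ℝ (Fin k)) (π (EuclideanSpace ℝ (Fin k)) P.VertBundle) where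
  toFun p := (p.1, P.vertCoord e₀ p.1 p.2)
  invFun p := ⟨p.1, P.vertSymm e₀ p.1 p.2⟩
  source := TotalSpace.proj ⁻¹' P.vertDom e₀
  target := P.vertDom e₀ ×ˢ univ
  map_source' _ h := ⟨h, mem_univ _⟩
  map_target' _ h := h.1
  left_inv' := fun ⟨e, v⟩ h => by
    refine congrArg (TotalSpace.mk e) (P.vertCoord_injective h ?_)
    exact P.vertCoord_vertSymm h _
  right_inv' := fun ⟨e, w⟩ h => by
    refine Prod.ext rfl ?_
    exact P.vertCoord_vertSymm h.1 w
  open_target := (P.isOpen_vertDom e₀).prod isOpen_univ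
  baseSet := P.vertDom e₀
  open_baseSet := P.isOpen_vertDom e₀
  source_eq := rfl
  target_eq := rfl
  proj_toFun _ _ := rfl

/-- Transition functions of `Vπ`. -/
def vertCoordChange (e₀ e₁ e : E) : EuclideanSpace ℝ (Fin k) →L[ℝ] EuclideanSpace ℝ (Fin k) :=
  (P.compl e₁).comp ((((trivializationAt (EuclideanSpace ℝ (Fin (n + k)))
    (TangentSpace (𝓡 (n + k)) : E → Type _) e₀).coordChangeL ℝ
    (trivializationAt (EuclideanSpace ℝ (Fin (n + k)))
    (TangentSpace (𝓡 (n + k)) : E → Type _) e₁) e : EuclideanSpace ℝ (Fin (n + k)) →L[ℝ] EuclideanSpace ℝ (Fin (n + k)))).comp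
    ((P.splitting e₀ e).inverse.comp
      (ContinuousLinearMap.inr ℝ (EuclideanSpace ℝ (Fin n)) (EuclideanSpace ℝ (Fin k)))))

lemma contMDiffOn_vertCoordChange (e₀ e₁ : E) :
    ContMDiffOn (𝓡 (n + k)) 𝓘(ℝ, EuclideanSpace ℝ (Fin k) →L[ℝ] EuclideanSpace ℝ (Fin k)) ∞
      (P.vertCoordChange e₀ e₁) (P.vertDom e₀ ∩ P.vertDom e₁) := by
  refine ContMDiffOn.clm_comp contMDiffOn_const (ContMDiffOn.clm_comp ?_ (ContMDiffOn.clm_comp ?_ contMDiffOn_const))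
  · exact (contMDiffOn_coordChangeL _ _).mono (inter_subset_inter (fun e h => h.1.1) (fun e h => h.1.1))
  · exact (P.contMDiffOn_inverse_splitting e₀).mono inter_subset_left

lemma vertCoordChange_apply {e₀ e₁ e : E} (h : e ∈ P.vertDom e₀ ∩ P.vertDom e₁)
    (w : EuclideanSpace ℝ (Fin k)) :
    P.vertCoordChange e₀ e₁ e w = (P.vertPretriv e₁ ⟨e, (P.vertPretriv e₀).symm e w⟩).2 := by
  rw [Pretrivialization.symm_apply _ h.1]
  change _ = P.vertCoord e₁ e (P.vertSymm e₀ e w)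
  simp only [vertCoord, ContinuousLinearMap.comp_apply, vertCoordChange]
  rw [P.vertIncl_vertSymm h.1]
  simp only [ContinuousLinearEquiv.coe_coe]
  rw [Trivialization.coordChangeL_apply _ _ ⟨h.1.1.1, h.2.1.1⟩]
  rw [Trivialization.continuousLinearMapAt_apply, Trivialization.coe_linearMapAt_of_mem _ h.2.1.1,
    Trivialization.symmL_apply _ h.1.1.1]
  rfl

/-- `Vπ` as a vector bundle of rank `k`. -/
def vertPrebundle : VectorPrebundle ℝ (EuclideanSpace ℝ (Fin k)) P.VertBundle where
  pretrivializationAtlas := range P.vertPretriv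
  pretrivialization_linear' := by
    rintro _ ⟨e₀, rfl⟩
    exact ⟨fun e _ => ⟨map_add (P.vertCoord e₀ e), map_smul (P.vertCoord e₀ e)⟩⟩
  pretrivializationAt := P.vertPretriv
  mem_base_pretrivializationAt := P.mem_vertDom
  pretrivialization_mem_atlas e := mem_range_self e
  exists_coordChange := by
    rintro _ ⟨e₀, rfl⟩ _ ⟨e₁, rfl⟩
    exact ⟨P.vertCoordChange e₀ e₁, (P.contMDiffOn_vertCoordChange e₀ e₁).continuousOn,
      fun _ h w => P.vertCoordChange_apply h w⟩
  totalSpaceMk_isInducing e := by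
    refine Topology.isInducing_const_prod.2 ?_
    have : T2Space (TangentSpace (𝓡 (n + k)) e) :=
      inferInstanceAs (T2Space (EuclideanSpace ℝ (Fin (n + k))))
    have : FiniteDimensional ℝ (TangentSpace (𝓡 (n + k)) e) :=
      inferInstanceAs (FiniteDimensional ℝ (EuclideanSpace ℝ (Fin (n + k))))
    have : T2Space (P.VertBundle e) := inferInstanceAs (T2Space (P.vertical e))
    have : FiniteDimensional ℝ (P.VertBundle e) := inferInstanceAs (FiniteDimensional ℝ (P.vertical e))
    exact (LinearMap.isClosedEmbedding_of_injective (f := (P.vertCoord e e).toLinearMap)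
      (LinearMap.ker_eq_bot.2 (P.vertCoord_injective (P.mem_vertDom e)))).isInducing

instance : TopologicalSpace (TotalSpace (EuclideanSpace ℝ (Fin k)) P.VertBundle) :=
  P.vertPrebundle.totalSpaceTopology
instance : FiberBundle (EuclideanSpace ℝ (Fin k)) P.VertBundle := P.vertPrebundle.toFiberBundle
instance : VectorBundle ℝ (EuclideanSpace ℝ (Fin k)) P.VertBundle := P.vertPrebundle.toVectorBundle
instance : P.vertPrebundle.IsContMDiff (𝓡 (n + k)) ∞ where
  exists_contMDiffCoordChange := by
    rintro _ ⟨e₀, rfl⟩ _ ⟨e₁, rfl⟩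
    exact ⟨P.vertCoordChange e₀ e₁, P.contMDiffOn_vertCoordChange e₀ e₁,
      fun _ h w => P.vertCoordChange_apply h w⟩
instance : ContMDiffVectorBundle ∞ (EuclideanSpace ℝ (Fin k)) P.VertBundle (𝓡 (n + k)) :=
  P.vertPrebundle.contMDiffVectorBundle (𝓡 (n + k))


instance (e : E) : T2Space (P.PullTM e) := inferInstanceAs (T2Space (TangentSpace (𝓡 n) (P.proj e)))
instance (e : E) : FiniteDimensional ℝ (P.PullTM e) :=
  inferInstanceAs (FiniteDimensional ℝ (TangentSpace (𝓡 n) (P.proj e)))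
instance (e : E) : T2Space (P.VertBundle e) := inferInstanceAs (T2Space (P.vertical e))
instance (e : E) : FiniteDimensional ℝ (P.VertBundle e) :=
  inferInstanceAs (FiniteDimensional ℝ (P.vertical e))

lemma finrank_pullTM (e : E) : Module.finrank ℝ (P.PullTM e) = n := finrank_tangentSpace (P.proj e)

lemma finrank_vertBundle (e : E) : Module.finrank ℝ (P.VertBundle e) = k := by
  have h := (P.dproj e).toLinearMap.finrank_range_add_finrank_ker
  rw [LinearMap.range_eq_top.2 (show Function.Surjective (P.dproj e) from P.submersion e),
    finrank_top, P.finrank_pullTM, finrank_tangentSpace] at h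
  exact Nat.add_left_cancel h

variable (n k E) in
/-- The manifold `Hom(ℝ^(n+k), TE)`, where `ℝ^(n+k)` has the coordinates `(z^i, z^A)`. -/
abbrev FrameTotal : Type _ :=
  TotalSpace ((Fin n ⊕ Fin k → ℝ) →L[ℝ] EuclideanSpace ℝ (Fin (n + k)))
    (fun e : E => Trivial E (Fin n ⊕ Fin k → ℝ) e →L[ℝ] TangentSpace (𝓡 (n + k)) e)

variable (n k) in
/-- The model of the manifolds `Hom(ℝ^(n+k), TE)` and `LE`. -/
abbrev linearFrameModel :=
  (𝓡 (n + k)).prod 𝓘(ℝ, (Fin n ⊕ Fin k → ℝ) →L[ℝ] EuclideanSpace ℝ (Fin (n + k)))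

variable (n k E) in
lemma isOpen_frames : IsOpen {u : FrameTotal n k E | u.2.IsInvertible} := by
  rw [isOpen_iff_forall_mem_open]
  intro u₀ hu₀
  let t := trivializationAt ((Fin n ⊕ Fin k → ℝ) →L[ℝ] EuclideanSpace ℝ (Fin (n + k)))
    (fun e : E => Trivial E (Fin n ⊕ Fin k → ℝ) e →L[ℝ] TangentSpace (𝓡 (n + k)) e) u₀.1
  have key : ∀ u ∈ t.source, ((t u).2.IsInvertible ↔ u.2.IsInvertible) := by
    intro u hu
    have h1 : (t u).2 = _ := congrArg Prod.snd (hom_trivializationAt_apply (RingHom.id ℝ) u₀.1 u)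
    rw [h1, ContinuousLinearMap.inCoordinates_eq hu.1 hu.2]
    rw [ContinuousLinearMap.isInvertible_equiv_comp, ContinuousLinearMap.isInvertible_comp_equiv]
  refine ⟨t.source ∩ (fun u => (t u).2) ⁻¹' {f | f.IsInvertible}, ?_, ?_, ?_, ?_⟩
  · rintro u ⟨hu, hu'⟩
    exact (key u hu).1 hu'
  · exact (continuous_snd.comp_continuousOn t.continuousOn).isOpen_inter_preimage t.open_source
      ContinuousLinearEquiv.isOpen
  · exact FiberBundle.mem_trivializationAt_proj_source
  · exact (key u₀ FiberBundle.mem_trivializationAt_proj_source).2 hu₀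

/-- The manifold `Hom(ℝ^n, TE) ⊕ Hom(ℝ^k, Vπ)`. -/
abbrev AdaptedTotal : Type _ :=
  TotalSpace (((Fin n → ℝ) →L[ℝ] EuclideanSpace ℝ (Fin (n + k))) ×
      ((Fin k → ℝ) →L[ℝ] EuclideanSpace ℝ (Fin k)))
    ((fun e : E => Trivial E (Fin n → ℝ) e →L[ℝ] TangentSpace (𝓡 (n + k)) e) ×ᵇ
      (fun e : E => Trivial E (Fin k → ℝ) e →L[ℝ] P.VertBundle e))

variable (n k) in
/-- The model of the manifolds `Hom(ℝ^n, TE) ⊕ Hom(ℝ^k, Vπ)` and `L_π E`. -/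
abbrev adaptedModel :=
  (𝓡 (n + k)).prod 𝓘(ℝ, ((Fin n → ℝ) →L[ℝ] EuclideanSpace ℝ (Fin (n + k))) ×
      ((Fin k → ℝ) →L[ℝ] EuclideanSpace ℝ (Fin k)))

variable {P} in
/-- The component `ℝ^n → T_e E`. -/
def AdaptedTotal.hor (u : P.AdaptedTotal) : (Fin n → ℝ) →L[ℝ] TangentSpace (𝓡 (n + k)) u.1 := u.2.1
variable {P} in
/-- The component `ℝ^k → V_e π`. -/
def AdaptedTotal.vert (u : P.AdaptedTotal) : (Fin k → ℝ) →L[ℝ] P.VertBundle u.1 := u.2.2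

variable {P} in
/-- The map `ℝ^(n+k) → T_e E` with the two components of `u`. -/
def AdaptedTotal.frame (u : P.AdaptedTotal) :
    (Fin n ⊕ Fin k → ℝ) →L[ℝ] TangentSpace (𝓡 (n + k)) u.1 :=
  u.hor.comp (ContinuousLinearMap.pi fun i => ContinuousLinearMap.proj (Sum.inl i)) +
  ((P.vertIncl u.1).comp u.vert).comp (ContinuousLinearMap.pi fun i => ContinuousLinearMap.proj (Sum.inr i))

lemma AdaptedTotal.frame_apply {P : FiberedManifold n k E M} (u : P.AdaptedTotal)
    (z : Fin n ⊕ Fin k → ℝ) :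
    u.frame z = u.hor (fun i => z (Sum.inl i)) +
      P.vertIncl u.1 (u.vert fun A => z (Sum.inr A)) := rfl

lemma AdaptedTotal.frame_single_inl {P : FiberedManifold n k E M} (u : P.AdaptedTotal) (i : Fin n) :
    u.frame (Pi.single (Sum.inl i) 1) = u.hor (Pi.single i 1) := by
  rw [AdaptedTotal.frame_apply]
  have h1 : (fun j : Fin n =>
      (Pi.single (Sum.inl i) 1 : Fin n ⊕ Fin k → ℝ) (Sum.inl j)) = Pi.single i 1 := by
    funext j; simp [Pi.single_apply]
  have h2 : (fun A : Fin k =>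
      (Pi.single (Sum.inl i) 1 : Fin n ⊕ Fin k → ℝ) (Sum.inr A)) = 0 := by
    funext A; simp
  have h0 : u.vert 0 = 0 := map_zero _
  rw [h1, h2, h0, map_zero, add_zero]

lemma AdaptedTotal.frame_single_inr {P : FiberedManifold n k E M} (u : P.AdaptedTotal) (A : Fin k) :
    u.frame (Pi.single (Sum.inr A) 1) = P.vertIncl u.1 (u.vert (Pi.single A 1)) := by
  rw [AdaptedTotal.frame_apply]
  have h1 : (fun j : Fin n =>
      (Pi.single (Sum.inr A) 1 : Fin n ⊕ Fin k → ℝ) (Sum.inl j)) = 0 := by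
    funext j; simp
  have h2 : (fun B : Fin k =>
      (Pi.single (Sum.inr A) 1 : Fin n ⊕ Fin k → ℝ) (Sum.inr B)) = Pi.single A 1 := by
    funext B; simp [Pi.single_apply]
  have h0 : u.hor 0 = 0 := map_zero _
  rw [h1, h2, h0, zero_add]

lemma frame_isInvertible_iff (u : P.AdaptedTotal) :
    u.frame.IsInvertible ↔ ((P.dproj u.1).comp u.hor).IsInvertible ∧ u.vert.IsInvertible := by
  have happ : ∀ z, u.frame z = u.hor (fun i => z (Sum.inl i)) + P.vertIncl u.1 (u.vert fun i => z (Sum.inr i)) :=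
    fun z => rfl
  have hV : ∀ v, P.dproj u.1 (P.vertIncl u.1 v) = 0 := fun v => v.2
  constructor
  · intro h
    have hg : u.vert.IsInvertible := by
      refine isInvertible_of_injective ?_ (by rw [finrank_vertBundle]; simp)
      rw [injective_iff_map_eq_zero]
      intro y hy
      have h1 : u.frame (Sum.elim 0 y) = 0 := by
        rw [happ]
        have : (fun i : Fin n => Sum.elim (0 : Fin n → ℝ) y (Sum.inl i)) = 0 := rfl
        rw [this, map_zero, zero_add]
        have : (fun i : Fin k => Sum.elim (0 : Fin n → ℝ) y (Sum.inr i)) = y := rfl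
        rw [this, hy, map_zero]
      have h2 := h.injective (h1.trans (map_zero _).symm)
      funext A
      exact congrFun h2 (Sum.inr A)
    refine ⟨isInvertible_of_injective ?_ (by rw [finrank_pullTM]; simp), hg⟩
    rw [injective_iff_map_eq_zero]
    intro x hx
    have hx' : u.hor x ∈ P.vertical u.1 := hx
    obtain ⟨v, hv⟩ : ∃ v : P.VertBundle u.1, P.vertIncl u.1 v = u.hor x := ⟨(⟨_, hx'⟩ : P.vertical u.1), rfl⟩
    obtain ⟨y, hy⟩ := hg.surjective v
    have h1 : u.frame (Sum.elim x (-y)) = 0 := by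
      rw [happ]
      have : (fun i : Fin k => Sum.elim x (-y) (Sum.inr i)) = -y := rfl
      rw [this, map_neg, hy, map_neg, hv]
      exact add_neg_cancel (u.hor x)
    have h2 := h.injective (h1.trans (map_zero _).symm)
    funext i
    exact congrFun h2 (Sum.inl i)
  · rintro ⟨h1, h2⟩
    refine isInvertible_of_injective ?_ (by rw [finrank_tangentSpace]; simp)
    rw [injective_iff_map_eq_zero]
    intro z hz
    rw [happ] at hz
    have h3 : (fun i => z (Sum.inl i)) = 0 := by
      refine h1.injective ?_
      have := congrArg (P.dproj u.1) hz
      rw [map_add, hV, add_zero, map_zero] at this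
      rw [map_zero]
      exact this
    rw [h3, map_zero, zero_add] at hz
    have h4 : (fun i => z (Sum.inr i)) = 0 := by
      refine h2.injective ?_
      rw [map_zero]
      exact Subtype.ext hz
    funext α
    rcases α with i | A
    · exact congrFun h3 i
    · exact congrFun h4 A

lemma isOpen_adaptedFrames : IsOpen {u : P.AdaptedTotal | u.frame.IsInvertible} := by
  simp only [P.frame_isInvertible_iff]
  rw [isOpen_iff_forall_mem_open]
  intro u₀ hu₀
  let t₁ := trivializationAt ((Fin n → ℝ) →L[ℝ] EuclideanSpace ℝ (Fin (n + k)))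
    (fun e : E => Trivial E (Fin n → ℝ) e →L[ℝ] TangentSpace (𝓡 (n + k)) e) u₀.1
  let t₂ := trivializationAt ((Fin k → ℝ) →L[ℝ] EuclideanSpace ℝ (Fin k))
    (fun e : E => Trivial E (Fin k → ℝ) e →L[ℝ] P.VertBundle e) u₀.1
  let t := trivializationAt (((Fin n → ℝ) →L[ℝ] EuclideanSpace ℝ (Fin (n + k))) ×
      ((Fin k → ℝ) →L[ℝ] EuclideanSpace ℝ (Fin k)))
    ((fun e : E => Trivial E (Fin n → ℝ) e →L[ℝ] TangentSpace (𝓡 (n + k)) e) ×ᵇ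
      (fun e : E => Trivial E (Fin k → ℝ) e →L[ℝ] P.VertBundle e)) u₀.1
  let S : Set P.AdaptedTotal := t.source ∩ TotalSpace.proj ⁻¹' P.chartDom u₀.1
  have hS : IsOpen S := t.open_source.inter ((P.isOpen_chartDom u₀.1).preimage (FiberBundle.continuous_proj _ _))
  let F : P.AdaptedTotal → (Fin n → ℝ) →L[ℝ] EuclideanSpace ℝ (Fin n) :=
    fun u => (P.coordDproj u₀.1 u.1).comp (t u).2.1
  let G : P.AdaptedTotal → (Fin k → ℝ) →L[ℝ] EuclideanSpace ℝ (Fin k) := fun u => (t u).2.2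
  have hc : ContinuousOn t S := t.continuousOn.mono inter_subset_left
  have hF : ContinuousOn F S := by
    refine ContinuousOn.clm_comp ?_ (continuous_fst.comp_continuousOn (continuous_snd.comp_continuousOn hc))
    exact (P.contMDiffOn_coordDproj u₀.1).continuousOn.comp (FiberBundle.continuous_proj _ _).continuousOn
      (fun u hu => hu.2)
  have hG : ContinuousOn G S := continuous_snd.comp_continuousOn (continuous_snd.comp_continuousOn hc)
  have keyG : ∀ u ∈ S, ((G u).IsInvertible ↔ u.vert.IsInvertible) := by
    intro u hu
    have h1 : G u = ContinuousLinearMap.inCoordinates (Fin k → ℝ) (Trivial E (Fin k → ℝ))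
      (EuclideanSpace ℝ (Fin k)) P.VertBundle u₀.1 u.1 u₀.1 u.1 u.vert := rfl
    rw [h1, ContinuousLinearMap.inCoordinates_eq hu.1.2.1 hu.1.2.2]
    rw [ContinuousLinearMap.isInvertible_equiv_comp, ContinuousLinearMap.isInvertible_comp_equiv]
  have keyF : ∀ u ∈ S, ((F u).IsInvertible ↔ ((P.dproj u.1).comp u.hor).IsInvertible) := by
    intro u hu
    have h2 : F u = (((trivializationAt (EuclideanSpace ℝ (Fin n)) P.PullTM u₀.1).continuousLinearEquivAt ℝ u.1 hu.2.2 : P.PullTM u.1 →L[ℝ] EuclideanSpace ℝ (Fin n)).comp ((P.dproj u.1).comp u.hor)).comp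
       (((trivializationAt (Fin n → ℝ) (Trivial E (Fin n → ℝ)) u₀.1).continuousLinearEquivAt ℝ u.1 hu.1.1.1).symm : (Fin n → ℝ) →L[ℝ] (Fin n → ℝ)) := by
      refine ContinuousLinearMap.ext fun x => ?_
      have h3 := P.coordDproj_continuousLinearMapAt hu.2 (u.hor
        ((trivializationAt (Fin n → ℝ) (Trivial E (Fin n → ℝ)) u₀.1).symmL ℝ u.1 x))
      simp only [ContinuousLinearMap.comp_apply, ContinuousLinearEquiv.coe_coe,
        Trivialization.symm_continuousLinearEquivAt_eq, Trivialization.coe_continuousLinearEquivAt_eq]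
      exact h3
    rw [h2]
    rw [ContinuousLinearMap.isInvertible_comp_equiv, ContinuousLinearMap.isInvertible_equiv_comp]
  refine ⟨S ∩ (fun u => (F u, G u)) ⁻¹' ({f | f.IsInvertible} ×ˢ {f | f.IsInvertible}), ?_, ?_, ?_⟩
  · rintro u ⟨hu, h1, h2⟩
    exact ⟨(keyF u hu).1 h1, (keyG u hu).1 h2⟩
  · exact (hF.prodMk hG).isOpen_inter_preimage hS (ContinuousLinearEquiv.isOpen.prod ContinuousLinearEquiv.isOpen)
  · have hm : u₀ ∈ S := ⟨FiberBundle.mem_trivializationAt_proj_source, P.mem_chartDom u₀.1⟩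
    exact ⟨hm, (keyF u₀ hm).2 hu₀.1, (keyG u₀ hm).2 hu₀.2⟩


lemma linearIndependent_map_single {W : Type*} [AddCommGroup W] [Module ℝ W]
    (f : (Fin n ⊕ Fin k → ℝ) →ₗ[ℝ] W) (hf : Function.Injective f) :
    LinearIndependent ℝ (fun α => f (Pi.single α 1)) := by
  have h := (Pi.basisFun ℝ (Fin n ⊕ Fin k)).linearIndependent.map' f (LinearMap.ker_eq_bot.2 hf)
  convert! h using 1
  funext α
  simp

lemma linearIndependent_comb {W : Type*} [AddCommGroup W] [Module ℝ W] {v : Fin n ⊕ Fin k → W}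
    (hv : LinearIndependent ℝ v) {g : Matrix (Fin n ⊕ Fin k) (Fin n ⊕ Fin k) ℝ}
    (hg : IsUnit g.det) : LinearIndependent ℝ (fun β => ∑ α, g α β • v α) := by
  rw [Fintype.linearIndependent_iff] at hv ⊢
  intro x hx
  have h1 : ∑ α, (g.mulVec x) α • v α = 0 := by
    rw [← hx]
    simp only [Matrix.mulVec, dotProduct, Finset.sum_smul, Finset.smul_sum, smul_smul]
    rw [Finset.sum_comm]
    simp only [mul_comm]
  have h2 : g.mulVec x = 0 := funext (hv _ h1)
  have h3 : x = 0 := by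
    have := congrArg (g⁻¹.mulVec) h2
    rwa [Matrix.mulVec_mulVec, Matrix.nonsing_inv_mul g hg, Matrix.one_mulVec, Matrix.mulVec_zero] at this
  exact congrFun h3

lemma linearCombination_isInvertible (e : E) {v : Fin n ⊕ Fin k → TangentSpace (𝓡 (n + k)) e}
    (hv : LinearIndependent ℝ v) :
    (LinearMap.toContinuousLinearMap (Fintype.linearCombination ℝ v)).IsInvertible :=
  isInvertible_of_injective (hv.fintypeLinearCombination_injective)
    (by rw [finrank_tangentSpace]; simp)

variable (n k E) in
/-- The bundle of linear frames `LE`, an open submanifold of the bundle `Hom(ℝ^(n+k), TE)`: a frame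
`(e_i, e_A)` at `e` is the linear isomorphism `ℝ^(n+k) → T_e E` carrying the standard basis to it. -/
def linearFrameBundle : TopologicalSpace.Opens (FrameTotal n k E) :=
  ⟨{u | u.2.IsInvertible}, isOpen_frames n k E⟩

/-- The projection `λ : LE → E`. -/
def linearFrameProj (u : linearFrameBundle n k E) : E := u.1.1

/-- The frame given by a basis `v` of `T_e E`. -/
def linearFrameMk (e : E) (v : Fin n ⊕ Fin k → TangentSpace (𝓡 (n + k)) e) (hv : LinearIndependent ℝ v) :
    linearFrameBundle n k E :=
  ⟨⟨e, LinearMap.toContinuousLinearMap (Fintype.linearCombination ℝ v)⟩, linearCombination_isInvertible e hv⟩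

/-- The dual frame `(e^α)` of a frame, as a map `T_e E → ℝ^(n+k)`. -/
def linearCoframe (u : linearFrameBundle n k E) :
    TangentSpace (𝓡 (n + k)) (linearFrameProj u) →L[ℝ] (Fin n ⊕ Fin k → ℝ) :=
  ContinuousLinearMap.inverse u.1.2

/-- The `ℝ^(n+k)`-valued soldering 1-form on `LE`: `θ^α_u(X) = e^α(λ_* X)`. -/
def linearSoldering (u : linearFrameBundle n k E) :
    TangentSpace (linearFrameModel n k) u →L[ℝ] (Fin n ⊕ Fin k → ℝ) :=
  (linearCoframe u).comp (mfderiv (linearFrameModel n k) (𝓡 (n + k)) linearFrameProj u)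

/-- The adapted frame bundle `L_π E`: frames `(e_i, e_A)` of `E` with all `e_A` vertical, as an open
submanifold of the vector bundle `Hom(ℝ^n, TE) ⊕ Hom(ℝ^k, Vπ)`. -/
def adaptedFrameBundle : TopologicalSpace.Opens P.AdaptedTotal :=
  ⟨{u | u.frame.IsInvertible}, P.isOpen_adaptedFrames⟩

variable {P}

/-- The projection `λ : L_π E → E`. -/
def adaptedProj (u : P.adaptedFrameBundle) : E := u.1.1

/-- The vectors of an adapted frame `u = (e_i, e_A)`: `e_i = frameVec u (inl i)` and
`e_A = frameVec u (inr A)`. -/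
def frameVec (u : P.adaptedFrameBundle) (α : Fin n ⊕ Fin k) : TangentSpace (𝓡 (n + k)) (adaptedProj u) :=
  u.1.frame (Pi.single α 1)

lemma linearIndependent_frameVec (u : P.adaptedFrameBundle) : LinearIndependent ℝ (frameVec u) :=
  linearIndependent_map_single u.1.frame.toLinearMap u.2.injective

lemma frameVec_inr_mem (u : P.adaptedFrameBundle) (A : Fin k) :
    frameVec u (Sum.inr A) ∈ P.vertical (adaptedProj u) := by
  have h : frameVec u (Sum.inr A) = P.vertIncl u.1.1 (u.1.vert (Pi.single A 1)) :=
    u.1.frame_single_inr A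
  rw [h]
  exact (u.1.vert (Pi.single A 1)).2

variable (P) in
/-- The pair of linear maps `ℝ^n → T_e E`, `ℝ^k → V_e π` given by `v = (v_i, v_A)`, `v_A` vertical. -/
def adaptedTotalMk (e : E) (v : Fin n ⊕ Fin k → TangentSpace (𝓡 (n + k)) e)
    (hvert : ∀ A, v (Sum.inr A) ∈ P.vertical e) : P.AdaptedTotal :=
  ⟨e, LinearMap.toContinuousLinearMap (Fintype.linearCombination ℝ fun i => v (Sum.inl i)),
    LinearMap.toContinuousLinearMap (Fintype.linearCombination ℝ fun A =>
      (show P.VertBundle e from (⟨v (Sum.inr A), hvert A⟩ : P.vertical e)))⟩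

lemma frame_adaptedTotalMk (e : E) (v : Fin n ⊕ Fin k → TangentSpace (𝓡 (n + k)) e)
    (hvert : ∀ A, v (Sum.inr A) ∈ P.vertical e) :
    (P.adaptedTotalMk e v hvert).frame =
      LinearMap.toContinuousLinearMap (Fintype.linearCombination ℝ v) := by
  refine ContinuousLinearMap.ext fun z => ?_
  change (∑ i, z (Sum.inl i) • v (Sum.inl i)) + P.vertIncl e (∑ A, z (Sum.inr A) •
    (show P.VertBundle e from (⟨v (Sum.inr A), hvert A⟩ : P.vertical e))) = ∑ α, z α • v α
  rw [map_sum, Fintype.sum_sum_type]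
  congr 1

variable (P) in
/-- The adapted frame given by a basis `v = (v_i, v_A)` of `T_e E` with all `v_A` vertical. -/
def adaptedMk (e : E) (v : Fin n ⊕ Fin k → TangentSpace (𝓡 (n + k)) e)
    (hv : LinearIndependent ℝ v) (hvert : ∀ A, v (Sum.inr A) ∈ P.vertical e) :
    P.adaptedFrameBundle :=
  ⟨P.adaptedTotalMk e v hvert, by
    change ContinuousLinearMap.IsInvertible _
    rw [frame_adaptedTotalMk]
    exact linearCombination_isInvertible e hv⟩

lemma frameVec_adaptedMk (e : E) (v : Fin n ⊕ Fin k → TangentSpace (𝓡 (n + k)) e)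
    (hv : LinearIndependent ℝ v) (hvert : ∀ A, v (Sum.inr A) ∈ P.vertical e) :
    frameVec (P.adaptedMk e v hv hvert) = v := by
  funext α
  change (P.adaptedTotalMk e v hvert).frame (Pi.single α 1) = v α
  rw [frame_adaptedTotalMk]
  change Fintype.linearCombination ℝ v (Pi.single α 1) = v α
  simp

/-- The dual frame `(e^i, e^A)` of an adapted frame, as a map `T_e E → ℝ^(n+k)`. -/
def coframe (u : P.adaptedFrameBundle) :
    TangentSpace (𝓡 (n + k)) (adaptedProj u) →L[ℝ] (Fin n ⊕ Fin k → ℝ) :=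
  ContinuousLinearMap.inverse u.1.frame

/-- The soldering 1-form on `L_π E`, the restriction of that of `LE`: `θ^α_u(X) = e^α(λ_* X)`. -/
def soldering (u : P.adaptedFrameBundle) :
    TangentSpace (adaptedModel n k) u →L[ℝ] (Fin n ⊕ Fin k → ℝ) :=
  (coframe u).comp (mfderiv (adaptedModel n k) (𝓡 (n + k)) adaptedProj u)

/-- The right action `(u · g)_β = g^α_β e_α` on `L_π E` of an invertible block lower triangular
matrix `g`. -/
def adaptedAct (u : P.adaptedFrameBundle) (g : Matrix (Fin n ⊕ Fin k) (Fin n ⊕ Fin k) ℝ)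
    (hg : IsUnit g.det) (hblock : ∀ i A, g (Sum.inl i) (Sum.inr A) = 0) : P.adaptedFrameBundle :=
  P.adaptedMk (adaptedProj u) (fun β => ∑ α, g α β • frameVec u α)
    (linearIndependent_comb (linearIndependent_frameVec u) hg) (fun A => by
      rw [Fintype.sum_sum_type]
      simp only [hblock, zero_smul, Finset.sum_const_zero, zero_add]
      exact Submodule.sum_mem _ fun B _ => Submodule.smul_mem _ _ (frameVec_inr_mem u B))

/-- The standard basis element `E^i_A` of `gl(n + k, ℝ)`: `u · E^i_A` has `e_A` in place `i`. -/
def elemMat (i : Fin n) (A : Fin k) : Matrix (Fin n ⊕ Fin k) (Fin n ⊕ Fin k) ℝ :=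
  Matrix.single (Sum.inr A) (Sum.inl i) 1

lemma exp_smul_elemMat (i : Fin n) (A : Fin k) (t : ℝ) :
    NormedSpace.exp (t • elemMat i A) = 1 + t • elemMat i A := by
  have h2 : (t • elemMat i A) ^ 2 = 0 := by
    rw [pow_two]; simp [elemMat]
  have h3 : ∀ m, 2 ≤ m → (t • elemMat i A) ^ m = 0 := fun m hm => pow_eq_zero_of_le hm h2
  rw [NormedSpace.exp_eq_tsum ℝ]
  simp only
  rw [tsum_eq_sum (s := Finset.range 2)]
  · simp [Finset.sum_range_succ]
  · intro m hm
    rw [h3 m (by simp at hm; omega), smul_zero]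

/-- The derivative `E^{*i}_A(L)` of `L` along the fundamental vertical vector field
`E^{*i}_A(u) = d/dt (u · exp(t E^i_A))` at `t = 0`. -/
def vertDeriv (i : Fin n) (A : Fin k) (L : P.adaptedFrameBundle → ℝ) (u : P.adaptedFrameBundle) : ℝ :=
  deriv (fun t : ℝ => L (adaptedAct u (NormedSpace.exp (t • elemMat i A))
    ((Matrix.isUnit_iff_isUnit_det _).1 (Matrix.isUnit_exp _))
    (fun j B => by rw [exp_smul_elemMat]; simp [elemMat]))) 0

variable (P) in
/-- The manifold `Hom(π^* TM, TE)`. -/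
abbrev JetTotal : Type _ :=
  TotalSpace (EuclideanSpace ℝ (Fin n) →L[ℝ] EuclideanSpace ℝ (Fin (n + k)))
    (fun e : E => P.PullTM e →L[ℝ] TangentSpace (𝓡 (n + k)) e)

variable (P) in
/-- The first jet bundle `J^1 π`, the submanifold of `Hom(π^* TM, TE)` of the linear right inverses of
`π_*(e)`, `e ∈ E`. -/
def jetBundle : Set P.JetTotal :=
  {j | (P.dproj j.1).comp j.2 = ContinuousLinearMap.id ℝ (P.PullTM j.1)}

variable (n k) in
/-- The model of the manifold `Hom(π^* TM, TE)`. -/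
abbrev jetModel :=
  (𝓡 (n + k)).prod 𝓘(ℝ, EuclideanSpace ℝ (Fin n) →L[ℝ] EuclideanSpace ℝ (Fin (n + k)))

/-- Smooth functions on the embedded submanifold `J^1 π` of `Hom(π^* TM, TE)`: those that extend
locally to smooth functions on open sets of `Hom(π^* TM, TE)`. -/
def IsSmoothOnJets (f : P.jetBundle → ℝ) : Prop :=
  ∀ j₀ : P.jetBundle, ∃ U : Set P.JetTotal, IsOpen U ∧ (j₀ : P.JetTotal) ∈ U ∧
    ∃ F : P.JetTotal → ℝ, ContMDiffOn (jetModel n k) 𝓘(ℝ, ℝ) ∞ F U ∧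
      ∀ j : P.jetBundle, (j : P.JetTotal) ∈ U → F j = f j

/-- The projection `ρ : L_π E → J^1 π`, sending `(e_i, e_A)` to the linear map `π_* e_i ↦ e_i`; see
`jetProj_apply`. -/
def jetProj (u : P.adaptedFrameBundle) : P.jetBundle :=
  ⟨⟨adaptedProj u, u.1.hor.comp ((P.dproj (adaptedProj u)).comp u.1.hor).inverse⟩, by
    have h := ((P.frame_isInvertible_iff u.1).1 u.2).1
    exact h.self_comp_inverse⟩

lemma jetProj_apply (u : P.adaptedFrameBundle) (i : Fin n) :
    (jetProj u).1.2 (P.dproj (adaptedProj u) (frameVec u (Sum.inl i))) = frameVec u (Sum.inl i) := by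
  have h := ((P.frame_isInvertible_iff u.1).1 u.2).1
  have hv : frameVec u (Sum.inl i) = u.1.hor (Pi.single i 1) := u.1.frame_single_inl i
  rw [hv]
  exact congrArg u.1.hor (h.inverse_apply_self (Pi.single i 1))

/-- The pull-up `ρ^* f` to `L_π E` of a function `f` on `J^1 π`. -/
def pullUp (f : P.jetBundle → ℝ) (u : P.adaptedFrameBundle) : ℝ := f (jetProj u)

/-- The vectors `e_i / (τ L)` and `e_A - (1 / (τ L)) E^{*a}_A(L) e_a`, where `τ = τ(n)`. -/
def legendreVec (τ : ℕ → ℝ) (L : P.adaptedFrameBundle → ℝ) (u : P.adaptedFrameBundle) :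
    Fin n ⊕ Fin k → TangentSpace (𝓡 (n + k)) (adaptedProj u) :=
  Sum.elim (fun i => (1 / (τ n * L u)) • frameVec u (Sum.inl i))
    (fun A => frameVec u (Sum.inr A) -
      ∑ a, ((1 / (τ n * L u)) * vertDeriv a A L u) • frameVec u (Sum.inl a))

lemma linearIndependent_legendreVec {τ : ℕ → ℝ} (hτ : 0 < τ n) {L : P.adaptedFrameBundle → ℝ}
    {u : P.adaptedFrameBundle} (hL : L u ≠ 0) : LinearIndependent ℝ (legendreVec τ L u) := by
  let g : Matrix (Fin n ⊕ Fin k) (Fin n ⊕ Fin k) ℝ := Matrix.fromBlocks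
    ((1 / (τ n * L u)) • 1) (Matrix.of fun a A => -((1 / (τ n * L u)) * vertDeriv a A L u)) 0 1
  have hg : IsUnit g.det := by
    have h0 : τ n * L u ≠ 0 := mul_ne_zero hτ.ne' hL
    rw [Matrix.det_fromBlocks_zero₂₁, Matrix.det_smul]
    simp [hτ.ne', hL]
  convert! linearIndependent_comb (linearIndependent_frameVec u) hg using 1
  funext β
  rw [Fintype.sum_sum_type]
  rcases β with i | A
  · simp [g, legendreVec, Matrix.one_apply]
  · simp [g, legendreVec, Matrix.one_apply, sub_eq_neg_add]

/-- The `m`-symplectic Legendre transformation `φ_L : L_π E → LE` of a non-vanishing `L`. -/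
def legendre {τ : ℕ → ℝ} (hτ : 0 < τ n) {L : P.adaptedFrameBundle → ℝ} (hL : ∀ u, L u ≠ 0)
    (u : P.adaptedFrameBundle) : linearFrameBundle n k E :=
  linearFrameMk (adaptedProj u) (legendreVec τ L u) (linearIndependent_legendreVec hτ (hL u))

/-- The `ℝ^(n+k)`-valued Cartan-Hamilton-Poincaré 1-form on `L_π E`:
`θ^i_L = τ(n) L θ^i + E^{*i}_A(L) θ^A` and `θ^A_L = θ^A`. -/
def chpForm (τ : ℕ → ℝ) (L : P.adaptedFrameBundle → ℝ) (u : P.adaptedFrameBundle) :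
    TangentSpace (adaptedModel n k) u →L[ℝ] (Fin n ⊕ Fin k → ℝ) :=
  let θ : Fin n ⊕ Fin k → TangentSpace (adaptedModel n k) u →L[ℝ] ℝ :=
    fun α => (ContinuousLinearMap.proj α).comp (soldering u)
  ContinuousLinearMap.pi (Sum.elim
    (fun i => (τ n * L u) • θ (Sum.inl i) + ∑ A, vertDeriv i A L u • θ (Sum.inr A))
    (fun A => θ (Sum.inr A)))

end FiberedManifold

end

noncomputable section

/-! The Legendre transformation multiplies a frame on the right by a matrix depending on it: `φ_L(u)
= u ∘ g(u)`, where `g(u)` is block triangular with diagonal blocks `(τL)⁻¹ · 1` and `1` and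
off-diagonal block `-(τL)⁻¹ E^{*a}_A(L)` (`linearCombination_legendreVec`). The dual frame of
`φ_L(u)` is therefore `g(u)⁻¹` applied to the dual frame of `u`, and `g(u)⁻¹` has blocks `τL · 1`,
`1` and `E^{*a}_A(L)`, exactly the coefficients of `θ̂_L` (`linearCoframe_legendre`). As `φ_L`
covers the identity of `E`, the chain rule turns this pointwise duality into the equality of forms
(`pullback_linearSoldering_legendre`).

Most of the work is the smoothness of `φ_L`, on which the chain rule also depends. In bundle
coordinates it reduces to that of `g`, hence of `L` and of the functions `E^{*a}_A(L)`. For `L`: the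
coordinate expression of `ρ` involves only a product and the inverse of an `n × n` matrix, so `ρ` is
smooth into `Hom(π^* TM, TE)` (`contMDiff_jetProj`) and can be composed with local extensions of the
Lagrangian (`contMDiff_pullUp`). For `E^{*a}_A(L)`: the square of `E^a_A` is zero, so `u · exp(t
E^a_A)` is affine in `t` and jointly smooth in `(u, t)` (`val_adaptedAct_exp`, `contMDiff_shear`);
the `t`-derivative at `0` of a jointly smooth function is smooth in `u` (`contMDiff_vertDeriv`). -/

/-- The charts of an open submanifold are restrictions of ambient charts, so both sides have the
same coordinate expression; only continuity has to be transferred. This lets maps into frame bundles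
be treated as maps into the ambient vector bundles. -/
lemma TopologicalSpace.Opens.contMDiffAt_iff_val {𝕜 : Type*} [NontriviallyNormedField 𝕜]
    {G : Type*} [NormedAddCommGroup G] [NormedSpace 𝕜 G] {H : Type*} [TopologicalSpace H]
    {I : ModelWithCorners 𝕜 G H} {N : Type*} [TopologicalSpace N] [ChartedSpace H N]
    {G' : Type*} [NormedAddCommGroup G'] [NormedSpace 𝕜 G'] {H' : Type*} [TopologicalSpace H']
    {I' : ModelWithCorners 𝕜 G' H'} {N' : Type*} [TopologicalSpace N'] [ChartedSpace H' N']
    {m : WithTop ℕ∞} {U : TopologicalSpace.Opens N'} {f : N → U} {x : N} :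
    ContMDiffAt I I' m f x ↔ ContMDiffAt I I' m (fun y => (f y : N')) x := by
  rw [contMDiffAt_iff, contMDiffAt_iff, Topology.IsInducing.subtypeVal.continuousAt_iff]
  exact Iff.rfl

namespace FiberedManifold

variable {n k : ℕ} {E M : Type*}
  [TopologicalSpace M] [ChartedSpace (EuclideanSpace ℝ (Fin n)) M] [IsManifold (𝓡 n) ∞ M]
  [TopologicalSpace E] [ChartedSpace (EuclideanSpace ℝ (Fin (n + k))) E]
  [IsManifold (𝓡 (n + k)) ∞ E]

/-! ### Smoothness of maps into the frame and jet spaces, in bundle coordinates -/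

/-- The trivialization of `TE` given by the chart at `e₀`, on fibres. -/
def tangentCoord (e₀ e : E) : TangentSpace (𝓡 (n + k)) e →L[ℝ] EuclideanSpace ℝ (Fin (n + k)) :=
  (trivializationAt (EuclideanSpace ℝ (Fin (n + k))) (TangentSpace (𝓡 (n + k)) : E → Type _)
    e₀).continuousLinearMapAt ℝ e

lemma symmL_trivializationAt_trivial {F : Type*} [NormedAddCommGroup F] [NormedSpace ℝ F]
    (e₀ e : E) (z : F) : (trivializationAt F (Trivial E F) e₀).symmL ℝ e z = z :=
  DFunLike.congr_fun (Bundle.Trivial.symmL_trivialization ℝ E F e) z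

variable {G : Type*} [NormedAddCommGroup G] [NormedSpace ℝ G] {H : Type*} [TopologicalSpace H]
  {I : ModelWithCorners ℝ G H} {N : Type*} [TopologicalSpace N] [ChartedSpace H N]

/-- The general criterion for Hom bundles also conjugates by the trivialization of the source; here
the source is a trivial bundle, so that factor is the identity. -/
lemma contMDiffAt_frameTotal {f : N → FrameTotal n k E} {x₀ : N} :
    ContMDiffAt I (linearFrameModel n k) ∞ f x₀ ↔
      ContMDiffAt I (𝓡 (n + k)) ∞ (fun x => (f x).1) x₀ ∧
      ContMDiffAt I 𝓘(ℝ, (Fin n ⊕ Fin k → ℝ) →L[ℝ] EuclideanSpace ℝ (Fin (n + k))) ∞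
        (fun x => (tangentCoord (f x₀).1 (f x).1).comp
          (show (Fin n ⊕ Fin k → ℝ) →L[ℝ] TangentSpace (𝓡 (n + k)) (f x).1 from (f x).2)) x₀ := by
  rw [contMDiffAt_hom_bundle]
  refine and_congr_right fun _ => iff_of_eq ?_
  congr 1
  funext x
  refine ContinuousLinearMap.ext fun z => ?_
  exact congrArg (fun w => tangentCoord (f x₀).1 (f x).1 ((f x).2 w))
    (symmL_trivializationAt_trivial (f x₀).1 (f x).1 z)

variable (P : FiberedManifold n k E M)

lemma contMDiffAt_jetTotal {f : N → P.JetTotal} {x₀ : N} :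
    ContMDiffAt I (jetModel n k) ∞ f x₀ ↔
      ContMDiffAt I (𝓡 (n + k)) ∞ (fun x => (f x).1) x₀ ∧
      ContMDiffAt I 𝓘(ℝ, EuclideanSpace ℝ (Fin n) →L[ℝ] EuclideanSpace ℝ (Fin (n + k))) ∞
        (fun x => (tangentCoord (f x₀).1 (f x).1).comp ((f x).2.comp
          ((trivializationAt (EuclideanSpace ℝ (Fin n)) P.PullTM (f x₀).1).symmL ℝ (f x).1))) x₀ :=
  contMDiffAt_hom_bundle f

lemma contMDiffAt_adaptedTotal {f : N → P.AdaptedTotal} {x₀ : N} :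
    ContMDiffAt I (adaptedModel n k) ∞ f x₀ ↔
      ContMDiffAt I (𝓡 (n + k)) ∞ (fun x => (f x).1) x₀ ∧
      ContMDiffAt I 𝓘(ℝ, (Fin n → ℝ) →L[ℝ] EuclideanSpace ℝ (Fin (n + k))) ∞
        (fun x => (tangentCoord (f x₀).1 (f x).1).comp (f x).hor) x₀ ∧
      ContMDiffAt I 𝓘(ℝ, (Fin k → ℝ) →L[ℝ] EuclideanSpace ℝ (Fin k)) ∞
        (fun x => (P.vertCoord (f x₀).1 (f x).1).comp (f x).vert) x₀ := by
  rw [contMDiffAt_totalSpace]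
  refine and_congr_right fun hb => ?_
  rw [contMDiffAt_prod_module_iff]
  refine and_congr (iff_of_eq ?_) ?_
  · congr 1
    funext x
    refine ContinuousLinearMap.ext fun z => ?_
    have h : ((trivializationAt (((Fin n → ℝ) →L[ℝ] EuclideanSpace ℝ (Fin (n + k))) ×
      ((Fin k → ℝ) →L[ℝ] EuclideanSpace ℝ (Fin k)))
      ((fun e : E => Trivial E (Fin n → ℝ) e →L[ℝ] TangentSpace (𝓡 (n + k)) e) ×ᵇ
      (fun e : E => Trivial E (Fin k → ℝ) e →L[ℝ] P.VertBundle e)) (f x₀).1) (f x)).2.1 =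
      ContinuousLinearMap.inCoordinates (Fin n → ℝ) (Trivial E (Fin n → ℝ))
      (EuclideanSpace ℝ (Fin (n + k))) (TangentSpace (𝓡 (n + k))) (f x₀).1 (f x).1 (f x₀).1 (f x).1
      (f x).hor := rfl
    simp only [Function.comp_apply]
    rw [h]
    exact congrArg (fun w => tangentCoord (f x₀).1 (f x).1 ((f x).hor w))
      (symmL_trivializationAt_trivial (f x₀).1 (f x).1 z)
  -- The two coordinate expressions agree only near `x₀`: off its base set the fibre map of a
  -- trivialization is zero by default, whereas `vertCoord` is given by one formula everywhere.
  · refine Filter.EventuallyEq.contMDiffAt_iff ?_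
    filter_upwards [hb.continuousAt.preimage_mem_nhds
      ((P.isOpen_vertDom (f x₀).1).mem_nhds (P.mem_vertDom (f x₀).1))] with x hx
    refine ContinuousLinearMap.ext fun z => ?_
    have h : ((trivializationAt (((Fin n → ℝ) →L[ℝ] EuclideanSpace ℝ (Fin (n + k))) ×
      ((Fin k → ℝ) →L[ℝ] EuclideanSpace ℝ (Fin k)))
      ((fun e : E => Trivial E (Fin n → ℝ) e →L[ℝ] TangentSpace (𝓡 (n + k)) e) ×ᵇ
      (fun e : E => Trivial E (Fin k → ℝ) e →L[ℝ] P.VertBundle e)) (f x₀).1) (f x)).2.2 =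
      ContinuousLinearMap.inCoordinates (Fin k → ℝ) (Trivial E (Fin k → ℝ))
      (EuclideanSpace ℝ (Fin k)) P.VertBundle (f x₀).1 (f x).1 (f x₀).1 (f x).1
      (f x).vert := rfl
    simp only [Function.comp_apply]
    rw [h]
    simp only [ContinuousLinearMap.inCoordinates, ContinuousLinearMap.comp_apply]
    rw [Trivialization.continuousLinearMapAt_apply, Trivialization.coe_linearMapAt_of_mem _ hx]
    exact congrArg (fun w => P.vertCoord (f x₀).1 (f x).1 ((f x).vert w))
      (symmL_trivializationAt_trivial (f x₀).1 (f x).1 z)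

/-! ### The inclusion of the vertical bundle into the tangent bundle -/

/-- `splitting` sends the coordinates of a vertical vector to a pair with first entry `0`, and the
second entry is by definition its coordinate in `Vπ`. This is the coordinate form of the inclusion
`Vπ → TE`. -/
lemma tangentCoord_vertIncl {e₀ e : E} (h : e ∈ P.vertDom e₀) (v : P.VertBundle e) :
    tangentCoord e₀ e (P.vertIncl e v) = (P.splitting e₀ e).inverse (0, P.vertCoord e₀ e v) := by
  -- `vertSymm` is a right inverse of the injective map `vertCoord`, hence also a left inverse, so
  -- every vertical vector has this form.
  obtain ⟨w, rfl⟩ : ∃ w, P.vertSymm e₀ e w = v :=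
    ⟨_, P.vertCoord_injective h (P.vertCoord_vertSymm h (P.vertCoord e₀ e v))⟩
  rw [P.vertCoord_vertSymm h, P.vertIncl_vertSymm h]
  exact Trivialization.continuousLinearMapAt_symmL _ h.1.1 _

variable {P}

lemma eventually_mem_vertDom {b : N → E} {x₀ : N} (hb : ContinuousAt b x₀) :
    ∀ᶠ x in 𝓝 x₀, b x ∈ P.vertDom (b x₀) :=
  hb.preimage_mem_nhds ((P.isOpen_vertDom (b x₀)).mem_nhds (P.mem_vertDom (b x₀)))

lemma contMDiffAt_inverse_splitting {b : N → E} {x₀ : N} (hb : ContMDiffAt I (𝓡 (n + k)) ∞ b x₀) :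
    ContMDiffAt I 𝓘(ℝ, EuclideanSpace ℝ (Fin n) × EuclideanSpace ℝ (Fin k) →L[ℝ]
      EuclideanSpace ℝ (Fin (n + k))) ∞ (fun x => (P.splitting (b x₀) (b x)).inverse) x₀ :=
  ((P.contMDiffOn_inverse_splitting (b x₀)).contMDiffAt
    ((P.isOpen_vertDom (b x₀)).mem_nhds (P.mem_vertDom (b x₀)))).comp x₀ hb

/-- The vectors `e_A` are stored as elements of `Vπ`, while frames of `E` and the sheared vectors
`e_i + t e_A` need them in `TE`. -/
lemma contMDiffAt_tangentCoord_vert {f : N → P.AdaptedTotal} {x₀ : N}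
    (hf : ContMDiffAt I (adaptedModel n k) ∞ f x₀) :
    ContMDiffAt I 𝓘(ℝ, (Fin k → ℝ) →L[ℝ] EuclideanSpace ℝ (Fin (n + k))) ∞
      (fun x => (tangentCoord (f x₀).1 (f x).1).comp ((P.vertIncl (f x).1).comp (f x).vert)) x₀ := by
  obtain ⟨hb, -, hv⟩ := P.contMDiffAt_adaptedTotal.1 hf
  refine ((contMDiffAt_inverse_splitting (P := P) hb).clm_comp
    ((contMDiffAt_const (c := ContinuousLinearMap.inr ℝ (EuclideanSpace ℝ (Fin n))
      (EuclideanSpace ℝ (Fin k)))).clm_comp hv)).congr_of_eventuallyEq ?_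
  filter_upwards [eventually_mem_vertDom (P := P) hb.continuousAt] with x hx
  exact ContinuousLinearMap.ext fun z => P.tangentCoord_vertIncl hx _

lemma contMDiffAt_tangentCoord_frame {f : N → P.AdaptedTotal} {x₀ : N}
    (hf : ContMDiffAt I (adaptedModel n k) ∞ f x₀) :
    ContMDiffAt I 𝓘(ℝ, (Fin n ⊕ Fin k → ℝ) →L[ℝ] EuclideanSpace ℝ (Fin (n + k))) ∞
      (fun x => (tangentCoord (f x₀).1 (f x).1).comp (f x).frame) x₀ := by
  refine (((P.contMDiffAt_adaptedTotal.1 hf).2.1.clm_comp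
    (contMDiffAt_const (c := ContinuousLinearMap.pi fun i : Fin n =>
      ContinuousLinearMap.proj (R := ℝ) (φ := fun _ : Fin n ⊕ Fin k => ℝ) (Sum.inl i)))).add
    ((contMDiffAt_tangentCoord_vert hf).clm_comp
    (contMDiffAt_const (c := ContinuousLinearMap.pi fun i : Fin k =>
      ContinuousLinearMap.proj (R := ℝ) (φ := fun _ : Fin n ⊕ Fin k => ℝ) (Sum.inr i))))).congr_of_eventuallyEq
        (.of_forall fun x => ?_)
  exact ContinuousLinearMap.ext fun z => map_add (tangentCoord (f x₀).1 (f x).1) _ _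

lemma contMDiff_val_adaptedFrameBundle : ContMDiff (adaptedModel n k) (adaptedModel n k) ∞
    (fun u : P.adaptedFrameBundle => u.1) := contMDiff_subtype_val

/-! ### Smoothness of the jet projection and of the pulled-up Lagrangian -/

lemma contMDiff_jetProj : ContMDiff (adaptedModel n k) (jetModel n k) ∞
    (fun u : P.adaptedFrameBundle => (jetProj u : P.JetTotal)) := by
  intro u₀
  obtain ⟨hb, hh, -⟩ := P.contMDiffAt_adaptedTotal.1 (contMDiff_val_adaptedFrameBundle u₀)
  -- The `n × n` matrix of the vectors `π_* e_i` in the charts at `u₀`.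
  have hD : ContMDiffAt (adaptedModel n k) 𝓘(ℝ, (Fin n → ℝ) →L[ℝ] EuclideanSpace ℝ (Fin n)) ∞
      (fun u : P.adaptedFrameBundle => (P.coordDproj u₀.1.1 u.1.1).comp
        ((tangentCoord u₀.1.1 u.1.1).comp u.1.hor)) u₀ :=
    (((P.contMDiffOn_coordDproj u₀.1.1).contMDiffAt ((P.isOpen_chartDom _).mem_nhds
      (P.mem_chartDom _))).comp u₀ hb).clm_comp hh
  have key : ∀ u : P.adaptedFrameBundle, ∀ h : u.1.1 ∈ P.chartDom u₀.1.1,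
      (P.coordDproj u₀.1.1 u.1.1).comp ((tangentCoord u₀.1.1 u.1.1).comp u.1.hor) =
      (((trivializationAt (EuclideanSpace ℝ (Fin n)) P.PullTM u₀.1.1).continuousLinearEquivAt ℝ
        u.1.1 h.2 : P.PullTM u.1.1 ≃L[ℝ] EuclideanSpace ℝ (Fin n)) :
          P.PullTM u.1.1 →L[ℝ] EuclideanSpace ℝ (Fin n)).comp ((P.dproj u.1.1).comp u.1.hor) := by
    intro u h
    refine ContinuousLinearMap.ext fun z => ?_
    simp only [ContinuousLinearMap.comp_apply, ContinuousLinearEquiv.coe_coe,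
      Trivialization.coe_continuousLinearEquivAt_eq]
    exact P.coordDproj_continuousLinearMapAt h _
  -- For an adapted frame the `π_* e_i` form a basis of the tangent space of `M`; invertibility at
  -- `u₀` alone suffices for inversion to be smooth there.
  have hinv : ((P.coordDproj u₀.1.1 u₀.1.1).comp
      ((tangentCoord u₀.1.1 u₀.1.1).comp u₀.1.hor)).IsInvertible := by
    rw [key u₀ (P.mem_chartDom _), ContinuousLinearMap.isInvertible_equiv_comp]
    exact ((P.frame_isInvertible_iff u₀.1).1 u₀.2).1
  have hI : ContMDiffAt (adaptedModel n k) 𝓘(ℝ, EuclideanSpace ℝ (Fin n) →L[ℝ] (Fin n → ℝ)) ∞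
      (fun u : P.adaptedFrameBundle => ((P.coordDproj u₀.1.1 u.1.1).comp
        ((tangentCoord u₀.1.1 u.1.1).comp u.1.hor)).inverse) u₀ := by
    obtain ⟨φ, hφ⟩ := hinv
    have h1 : ContDiffAt ℝ ∞ ContinuousLinearMap.inverse ((P.coordDproj u₀.1.1 u₀.1.1).comp
        ((tangentCoord u₀.1.1 u₀.1.1).comp u₀.1.hor)) := by
      rw [← hφ]; exact contDiffAt_map_inverse φ
    exact h1.contMDiffAt.comp u₀ hD
  refine P.contMDiffAt_jetTotal.2 ⟨hb, (hh.clm_comp hI).congr_of_eventuallyEq ?_⟩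
  filter_upwards [eventually_mem_vertDom (P := P) hb.continuousAt] with u hu
  -- Inverting the composite moves the inverse of the trivialization of `π^* TM` to the right, where
  -- the coordinate expression of a jet has it.
  rw [key u hu.1, ContinuousLinearMap.inverse_equiv_comp]
  refine ContinuousLinearMap.ext fun z => ?_
  simp only [ContinuousLinearMap.comp_apply, ContinuousLinearEquiv.coe_coe,
      Trivialization.symm_continuousLinearEquivAt_eq]
  rfl

lemma contMDiff_pullUp {f : P.jetBundle → ℝ} (hf : IsSmoothOnJets f) :
    ContMDiff (adaptedModel n k) 𝓘(ℝ, ℝ) ∞ (pullUp f) := by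
  intro u₀
  obtain ⟨U, hU, hu₀, F, hF, hFf⟩ := hf (jetProj u₀)
  have hj := contMDiff_jetProj (P := P) u₀
  refine ((hF.contMDiffAt (hU.mem_nhds hu₀)).comp u₀ hj).congr_of_eventuallyEq ?_
  filter_upwards [hj.continuousAt.preimage_mem_nhds (hU.mem_nhds hu₀)] with u hu
  exact (hFf _ hu).symm

/-! ### Smoothness of the derivatives along fundamental vertical fields -/

/-- The linear map `ℝ^n → ℝ^k` sending the `i`-th basis vector to the `A`-th one and the others to
zero. -/
def unitMap (i : Fin n) (A : Fin k) : (Fin n → ℝ) →L[ℝ] (Fin k → ℝ) :=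
  (ContinuousLinearMap.proj (R := ℝ) (φ := fun _ : Fin n => ℝ) i).smulRight (Pi.single A 1)

/-- The components of `u · exp(t E^i_A)`. -/
def shear (i : Fin n) (A : Fin k) (u : P.AdaptedTotal) (t : ℝ) : P.AdaptedTotal :=
  ⟨u.1, u.hor + t • ((P.vertIncl u.1).comp u.vert).comp (unitMap i A), u.vert⟩

lemma _root_.LinearMap.apply_eq_sum_single {ι W : Type*} [Fintype ι] [DecidableEq ι]
    [AddCommGroup W] [Module ℝ W] (f : (ι → ℝ) →ₗ[ℝ] W) (z : ι → ℝ) :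
    f z = ∑ j, z j • f (Pi.single j 1) := by
  conv_lhs => rw [pi_eq_sum_univ' z]
  simp only [map_sum, map_smul]

lemma sum_exp_smul_elemMat_inl {W : Type*} [AddCommGroup W] [Module ℝ W] (i : Fin n) (A : Fin k)
    (t : ℝ) (v : Fin n ⊕ Fin k → W) (f : (Fin n → ℝ) →ₗ[ℝ] W)
    (hf : ∀ j, v (Sum.inl j) = f (Pi.single j 1)) (z : Fin n → ℝ) :
    ∑ j, z j • ∑ α, NormedSpace.exp (t • elemMat i A) α (Sum.inl j) • v α =
      f z + t • z i • v (Sum.inr A) := by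
  have hcol : ∀ j, ∑ α, NormedSpace.exp (t • elemMat i A) α (Sum.inl j) • v α =
      v (Sum.inl j) + (if j = i then t else 0) • v (Sum.inr A) := by
    intro j
    rw [exp_smul_elemMat, Fintype.sum_sum_type]
    simp [elemMat, Matrix.one_apply, Matrix.single_apply, ite_and, eq_comm]
  simp only [hcol, smul_add, smul_smul, Finset.sum_add_distrib, f.apply_eq_sum_single z, hf]
  refine congrArg _ ((Finset.sum_eq_single i (by intro j _ hj; simp [hj]) (by simp)).trans ?_)
  rw [if_pos rfl, mul_comm]

lemma sum_exp_smul_elemMat_inr {W : Type*} [AddCommGroup W] [Module ℝ W] (i : Fin n) (A : Fin k)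
    (t : ℝ) (v : Fin n ⊕ Fin k → W) (B : Fin k) :
    ∑ α, NormedSpace.exp (t • elemMat i A) α (Sum.inr B) • v α = v (Sum.inr B) := by
  rw [exp_smul_elemMat, Fintype.sum_sum_type]
  simp [elemMat, Matrix.one_apply]

/-- The exponential is `1 + t E^i_A`, so only `e_i` changes, to `e_i + t e_A`. The right-hand side
needs no invertibility: it makes sense on the whole vector bundle, where joint smoothness can be
read off. -/
lemma val_adaptedAct_exp (i : Fin n) (A : Fin k) (u : P.adaptedFrameBundle) (t : ℝ)
    (hg : IsUnit (NormedSpace.exp (t • elemMat (n := n) (k := k) i A)).det)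
    (hb : ∀ j B, NormedSpace.exp (t • elemMat (n := n) (k := k) i A) (Sum.inl j) (Sum.inr B) = 0) :
    (adaptedAct u (NormedSpace.exp (t • elemMat i A)) hg hb).1 = shear i A u.1 t := by
  have hinr : ∀ B, frameVec u (Sum.inr B) = P.vertIncl u.1.1 (u.1.vert (Pi.single B 1)) :=
    u.1.frame_single_inr
  refine congrArg (TotalSpace.mk u.1.1) (Prod.ext ?_ ?_)
  · refine ContinuousLinearMap.ext fun z => ?_
    refine (sum_exp_smul_elemMat_inl i A t (frameVec u) u.1.hor.toLinearMap
      u.1.frame_single_inl z).trans ?_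
    refine congrArg (fun w => u.1.hor z + t • w) ?_
    rw [hinr]
    exact ((P.vertIncl u.1.1).comp u.1.vert).map_smul (z i) (Pi.single A 1) |>.symm
  · refine ContinuousLinearMap.ext fun z =>
      Eq.trans ?_ (u.1.vert.toLinearMap.apply_eq_sum_single z).symm
    refine congrArg (fun v : Fin k → P.VertBundle u.1.1 => Fintype.linearCombination ℝ v z)
      (funext fun B => Subtype.ext ?_)
    exact (sum_exp_smul_elemMat_inr i A t (frameVec u) B).trans (hinr B)

lemma contMDiff_shear (i : Fin n) (A : Fin k) :
    ContMDiff ((adaptedModel n k).prod 𝓘(ℝ, ℝ)) (adaptedModel n k) ∞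
      (fun p : P.AdaptedTotal × ℝ => shear i A p.1 p.2) := by
  intro p₀
  have hf : ContMDiffAt ((adaptedModel n k).prod 𝓘(ℝ, ℝ)) (adaptedModel n k) ∞
      (fun p : P.AdaptedTotal × ℝ => p.1) p₀ := contMDiffAt_fst
  have hv := contMDiffAt_tangentCoord_vert hf
  obtain ⟨hb, hh, hV⟩ := P.contMDiffAt_adaptedTotal.1 hf
  refine P.contMDiffAt_adaptedTotal.2 ⟨hb, (hh.add (contMDiffAt_snd.smul (hv.clm_comp
    (contMDiffAt_const (c := unitMap i A))))).congr_of_eventuallyEq (.of_forall fun p => ?_), hV⟩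
  refine ContinuousLinearMap.ext fun z => ?_
  exact (map_add (tangentCoord p₀.1.1 p.1.1) _ _).trans
    (congrArg _ (map_smul (tangentCoord p₀.1.1 p.1.1) _ _))

lemma contMDiff_vertDeriv (i : Fin n) (A : Fin k) {L : P.adaptedFrameBundle → ℝ}
    (hL : ContMDiff (adaptedModel n k) 𝓘(ℝ, ℝ) ∞ L) :
    ContMDiff (adaptedModel n k) 𝓘(ℝ, ℝ) ∞ (vertDeriv i A L) := by
  intro u₀
  let f : P.adaptedFrameBundle → ℝ → ℝ := fun u t => L (adaptedAct u
    (NormedSpace.exp (t • elemMat i A)) ((Matrix.isUnit_iff_isUnit_det _).1 (Matrix.isUnit_exp _))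
    (fun j B => by rw [exp_smul_elemMat]; simp [elemMat]))
  have hf : ContMDiff ((adaptedModel n k).prod 𝓘(ℝ, ℝ)) 𝓘(ℝ, ℝ) ∞ (Function.uncurry f) := by
    refine hL.comp fun p => ?_
    rw [TopologicalSpace.Opens.contMDiffAt_iff_val]
    simp only [val_adaptedAct_exp]
    exact (contMDiff_shear i A).contMDiffAt.comp p
      ((contMDiff_val_adaptedFrameBundle.comp contMDiff_fst).prodMk contMDiff_snd).contMDiffAt
  have : IsManifold (adaptedModel n k) ∞ P.AdaptedTotal := inferInstance
  have : IsManifold (adaptedModel n k) ∞ P.adaptedFrameBundle := inferInstance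
  have : IsManifold (adaptedModel n k) 1 P.adaptedFrameBundle := .of_le (n := ∞) (by simp)
  -- Smooth dependence of a partial derivative on parameters, along the constant section `t = 0`;
  -- the order lost by differentiating costs nothing at `∞`.
  have h := (hf (u₀, (0 : ℝ))).mfderiv (m := ∞) f (fun _ => 0) contMDiffAt_const (by simp)
  refine (h.clm_apply (contMDiffAt_const (c := (1 : ℝ)))).congr_of_eventuallyEq
    (.of_forall fun u => ?_)
  simp only [inTangentCoordinates_model_space, mfderiv_eq_fderiv]
  exact (fderiv_apply_one_eq_deriv).symm

/-! ### The Legendre transformation as a matrix, and its smoothness -/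

variable (n k) in
/-- The linear map `ℝ^(n+k) → ℝ^(n+k)` sending the basis vector `A` to the basis vector `a` and the
others to zero. -/
def transfer (a : Fin n) (A : Fin k) : (Fin n ⊕ Fin k → ℝ) →L[ℝ] (Fin n ⊕ Fin k → ℝ) :=
  (ContinuousLinearMap.proj (R := ℝ) (φ := fun _ : Fin n ⊕ Fin k => ℝ) (Sum.inr A)).smulRight
    (Pi.single (Sum.inl a) 1)

variable (n k) in
/-- The projection of `ℝ^(n+k)` onto the basis vector `α`. -/
def coordProj (α : Fin n ⊕ Fin k) : (Fin n ⊕ Fin k → ℝ) →L[ℝ] (Fin n ⊕ Fin k → ℝ) :=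
  (ContinuousLinearMap.proj (R := ℝ) (φ := fun _ : Fin n ⊕ Fin k => ℝ) α).smulRight
    (Pi.single α 1)

/-- The matrix carrying the frame `u` to its Legendre transform. -/
def legendreMap (τ : ℕ → ℝ) (L : P.adaptedFrameBundle → ℝ) (u : P.adaptedFrameBundle) :
    (Fin n ⊕ Fin k → ℝ) →L[ℝ] (Fin n ⊕ Fin k → ℝ) :=
  (1 / (τ n * L u)) • ∑ i, coordProj n k (Sum.inl i) + (∑ A, coordProj n k (Sum.inr A) -
    ∑ A, ∑ a, ((1 / (τ n * L u)) * vertDeriv a A L u) • transfer n k a A)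

/-- This factors the Legendre transform as `u` composed with a matrix on the fixed space `ℝ^(n+k)`.
Its smoothness and its dual frame are then found by treating the matrix and the original frame
separately. -/
lemma linearCombination_legendreVec (τ : ℕ → ℝ) (L : P.adaptedFrameBundle → ℝ)
    (u : P.adaptedFrameBundle) (z : Fin n ⊕ Fin k → ℝ) :
    Fintype.linearCombination ℝ (legendreVec τ L u) z = u.1.frame (legendreMap τ L u z) := by
  have h : ∀ α, u.1.frame (Pi.single α 1) = frameVec u α := fun _ => rfl
  rw [Fintype.linearCombination_apply, Fintype.sum_sum_type]
  simp [legendreMap, transfer, coordProj, legendreVec, h, smul_sub, Finset.smul_sum, Finset.sum_sub_distrib, smul_smul,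
    mul_comm]
  rfl

lemma contMDiff_legendreMap {τ : ℕ → ℝ} (hτ : 0 < τ n) {L : P.adaptedFrameBundle → ℝ}
    (hL : ContMDiff (adaptedModel n k) 𝓘(ℝ, ℝ) ∞ L) (hne : ∀ u, L u ≠ 0) :
    ContMDiff (adaptedModel n k) 𝓘(ℝ, (Fin n ⊕ Fin k → ℝ) →L[ℝ] (Fin n ⊕ Fin k → ℝ)) ∞
      (legendreMap τ L) := by
  have hs : ContMDiff (adaptedModel n k) 𝓘(ℝ, ℝ) ∞ (fun u => 1 / (τ n * L u)) :=
    contMDiff_const.div₀ (contMDiff_const.mul hL) fun u => mul_ne_zero hτ.ne' (hne u)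
  refine (hs.smul contMDiff_const).add (contMDiff_const.sub ?_)
  refine contMDiff_finsetSum fun A _ => contMDiff_finsetSum fun a _ => ?_
  exact (hs.mul (contMDiff_vertDeriv a A hL)).smul contMDiff_const

lemma contMDiff_legendre {τ : ℕ → ℝ} (hτ : 0 < τ n) {L : P.adaptedFrameBundle → ℝ}
    (hL : ContMDiff (adaptedModel n k) 𝓘(ℝ, ℝ) ∞ L) (hne : ∀ u, L u ≠ 0) :
    ContMDiff (adaptedModel n k) (linearFrameModel n k) ∞ (legendre hτ hne) := by
  intro u₀
  rw [TopologicalSpace.Opens.contMDiffAt_iff_val, contMDiffAt_frameTotal]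
  refine ⟨(P.contMDiffAt_adaptedTotal.1 (contMDiff_val_adaptedFrameBundle u₀)).1, ?_⟩
  refine ((contMDiffAt_tangentCoord_frame (contMDiff_val_adaptedFrameBundle u₀)).clm_comp
    (contMDiff_legendreMap hτ hL hne u₀)).congr_of_eventuallyEq (.of_forall fun u => ?_)
  refine ContinuousLinearMap.ext fun z => ?_
  exact congrArg (tangentCoord u₀.1.1 u.1.1) (linearCombination_legendreVec τ L u z)

lemma contMDiff_linearFrameProj : ContMDiff (linearFrameModel n k) (𝓡 (n + k)) ∞
    (linearFrameProj : linearFrameBundle n k E → E) := fun u =>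
  (contMDiffAt_frameTotal.1 (contMDiff_subtype_val (n := ∞) u)).1

/-! ### The dual frame and the pull-back of the soldering form -/

/-- The dual of the Legendre transform of the frame `u`, in terms of the dual of `u`. -/
lemma linearCoframe_legendre {τ : ℕ → ℝ} (hτ : 0 < τ n) {L : P.adaptedFrameBundle → ℝ}
    (hne : ∀ u, L u ≠ 0) (u : P.adaptedFrameBundle)
    (X : TangentSpace (𝓡 (n + k)) (adaptedProj u)) :
    linearCoframe (legendre hτ hne u) X = Sum.elim
      (fun i => τ n * L u * coframe u X (Sum.inl i) +
        ∑ A, vertDeriv i A L u * coframe u X (Sum.inr A))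
      (fun A => coframe u X (Sum.inr A)) := by
  have hinv : ContinuousLinearMap.IsInvertible (legendre hτ hne u).1.2 := (legendre hτ hne u).2
  -- Instead of inverting the new frame, apply it to both sides: the left side becomes `X`, which is
  -- also `u` applied to its own coframe values.
  refine hinv.injective ((hinv.self_apply_inverse X).trans ?_)
  have h1 : u.1.frame (coframe u X) = X := u.2.self_apply_inverse X
  refine h1.symm.trans (Eq.trans ?_ (linearCombination_legendreVec τ L u _).symm)
  congr 1
  have h0 : τ n * L u ≠ 0 := mul_ne_zero hτ.ne' (hne u)
  -- What remains is linear algebra in `ℝ^(n+k)`: `legendreMap` undoes the matrix with blocks `τL ·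
  -- 1`, `E^{*i}_A(L)`, `0`, `1`.
  generalize coframe u X = z
  funext α
  rcases α with i | A
  · simp [legendreMap, transfer, coordProj, Pi.single_apply]
    rw [mul_add, Finset.mul_sum]
    have hL := hne u
    have ht := hτ.ne'
    field_simp
    ring
  · simp [legendreMap, transfer, coordProj, Pi.single_apply]

lemma pullback_linearSoldering_legendre {τ : ℕ → ℝ} (hτ : 0 < τ n) {L : P.adaptedFrameBundle → ℝ}
    (hL : ContMDiff (adaptedModel n k) 𝓘(ℝ, ℝ) ∞ L) (hne : ∀ u, L u ≠ 0)
    (u : P.adaptedFrameBundle) :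
    (linearSoldering (legendre hτ hne u)).comp
      (mfderiv (adaptedModel n k) (linearFrameModel n k) (legendre hτ hne) u) = chpForm τ L u := by
  -- The chain rule for `λ ∘ φ_L = λ`, an equality that holds by definition. Differentiability of
  -- `φ_L` is essential: otherwise its `mfderiv` would be `0` by default.
  have hcomp : mfderiv (adaptedModel n k) (𝓡 (n + k)) (adaptedProj : P.adaptedFrameBundle → E) u =
      (mfderiv (linearFrameModel n k) (𝓡 (n + k)) linearFrameProj (legendre hτ hne u)).comp
        (mfderiv (adaptedModel n k) (linearFrameModel n k) (legendre hτ hne) u) :=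
    mfderiv_comp u ((contMDiff_linearFrameProj _).mdifferentiableAt (by simp))
      ((contMDiff_legendre hτ hL hne u).mdifferentiableAt (by simp))
  refine ContinuousLinearMap.ext fun X => ?_
  have h1 := linearCoframe_legendre hτ hne u
    (mfderiv (adaptedModel n k) (𝓡 (n + k)) (adaptedProj : P.adaptedFrameBundle → E) u X)
  have h2 := congrArg (linearCoframe (legendre hτ hne u)) (DFunLike.congr_fun hcomp X)
  refine h2.symm.trans (h1.trans ?_)
  funext α
  rcases α with i | A
  · simp [chpForm, soldering]
  · simp [chpForm, soldering]

end FiberedManifold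

end

theorem mainTheorem4 {n k : ℕ} {E M : Type*}
    [TopologicalSpace M] [ChartedSpace (EuclideanSpace ℝ (Fin n)) M] [IsManifold (𝓡 n) ∞ M]
    [TopologicalSpace E] [ChartedSpace (EuclideanSpace ℝ (Fin (n + k))) E]
    [IsManifold (𝓡 (n + k)) ∞ E]
    (P : FiberedManifold n k E M)
    (τ : ℕ → ℝ) (hτ : ∀ j, 0 < τ j)
    (ℒ : P.jetBundle → ℝ) (hsmooth : FiberedManifold.IsSmoothOnJets ℒ)
    (L : P.adaptedFrameBundle → ℝ) (hpull : L = FiberedManifold.pullUp ℒ)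
    (hne : ∀ u, L u ≠ 0) :
    ContMDiff (FiberedManifold.adaptedModel n k) (FiberedManifold.linearFrameModel n k) ∞
        (FiberedManifold.legendre (hτ n) hne) ∧
      ∀ u : P.adaptedFrameBundle,
        (FiberedManifold.linearSoldering (FiberedManifold.legendre (hτ n) hne u)).comp
            (mfderiv (FiberedManifold.adaptedModel n k) (FiberedManifold.linearFrameModel n k)
              (FiberedManifold.legendre (hτ n) hne) u) =
          FiberedManifold.chpForm τ L u := by
  have hL : ContMDiff (FiberedManifold.adaptedModel n k) 𝓘(ℝ, ℝ) ∞ L :=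
    hpull ▸ FiberedManifold.contMDiff_pullUp hsmooth
  exact ⟨FiberedManifold.contMDiff_legendre (hτ n) hL hne,
    FiberedManifold.pullback_linearSoldering_legendre (hτ n) hL hne⟩
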